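/- Let $0\le\gamma\le 2$ and $\alpha=\frac{4-3\gamma}{\sqrt6}$. Let $V:\mathbb R\to\mathbb R$ be a potential of class $C^2$ belonging to the class $\mathfrak C$, i.e. such that (A1) the critical points of $V$ are isolated; (A2) there are $a<b$ with $V'(\phi)>0$ for $\phi\ge b$ and $V'(\phi)<0$ for $\phi\le a$, and, with $V_*=\max_{[a,b]}V$, the limits (in $[-\infty,+\infty]$) satisfy $\lim_{\phi\to-\infty}V(\phi)>V_*$ and $\lim_{\phi\to+\infty}V(\phi)>V_*$; (A3) the function $u=\frac{V'}{\sqrt6\,V}$ (defined for $|\phi|$ large) is such that the limits $\lim_{\phi\to+\infty}|u(\phi)|$ and $\lim_{\phi\to-\infty}|u(\phi)|$ exist and are both $<1$, and $\lim_{\phi\to\pm\infty}u'(\phi)=0$. Consider the system $$\begin{aligned} \frac{d\phi}{d\tau}&=-y,\\ \frac{dx}{d\tau}&=-\tfrac12x\,(y^2+\gamma z^2),\\ \frac{dy}{d\tau}&=V'(\phi)x^2+3y-\tfrac12y^3-z^2\left(\alpha+\tfrac{\gamma}{2}y\right),\\ \frac{dz}{d\tau}&=-\tfrac12z\left[y^2-\alpha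 y+\gamma(z^2-3)\right], \end{aligned}$$ and the three-dimensional submanifold $S\subset\mathbb R^4$ of the points $(\phi,x,y,z)$ with $$V(\phi)x^2+\tfrac12y^2+z^2=3,\qquad x<0 .$$ For a solution starting at $\tau=0$, let $\mathbb I\subseteq[0,+\infty)$ be its maximal right interval of definition. Every solution that lies in $S$ at $\tau=0$ lies in $S$ for all $\tau\in\mathbb I$. Moreover, for almost every initial point in $S$ (with respect to the three-dimensional Hausdorff measure, i.e. the surface measure of $S$), the solution $(\phi,x,y,z)$ starting there satisfies $$\limsup_{\tau\to\sup\mathbb I}|\phi(\tau)|=+\infty .$$ -/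

import Mathlib

open Filter Set MeasureTheory
open scoped Topology

noncomputable section

namespace ScalarCollapse

/-- The function `u = V' / (√6 V)`. -/
def growthRatio (V : ℝ → ℝ) (φ : ℝ) : ℝ :=
  deriv V φ / (Real.sqrt 6 * V φ)

/-- The class `ℭ` of potentials (of class `C²`, since `V''` is used throughout). -/
structure PotentialClass (V : ℝ → ℝ) : Prop where
  contDiff : ContDiff ℝ 2 V
  /-- (A1) the critical points of `V` are isolated. -/
  isolated_critical : ∀ φ₀ : ℝ, deriv V φ₀ = 0 → ∀ᶠ φ in 𝓝[≠] φ₀, deriv V φ ≠ 0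
  /-- (A2) `V' > 0` on `[b, ∞)`, `V' < 0` on `(-∞, a]`, and the limits of `V` at `±∞`
  (finite or infinite) are larger than `V_* = max_{[a,b]} V`. -/
  sublevel : ∃ a b : ℝ, a < b ∧
    (∀ φ, b ≤ φ → 0 < deriv V φ) ∧
    (∀ φ, φ ≤ a → deriv V φ < 0) ∧
    ∃ Vmax : ℝ, IsGreatest (V '' Icc a b) Vmax ∧
      (∃ L : EReal, Tendsto (fun φ : ℝ => (V φ : EReal)) atBot (𝓝 L) ∧ (Vmax : EReal) < L) ∧
      (∃ L : EReal, Tendsto (fun φ : ℝ => (V φ : EReal)) atTop (𝓝 L) ∧ (Vmax : EReal) < L)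
  /-- (A3) `|u|` has limits smaller than `1` at `±∞`; note that `V` has no zero near `±∞`,
  by (A2). -/
  growth_top : ∃ l : ℝ, l < 1 ∧ Tendsto (fun φ => |growthRatio V φ|) atTop (𝓝 l)
  growth_bot : ∃ l : ℝ, l < 1 ∧ Tendsto (fun φ => |growthRatio V φ|) atBot (𝓝 l)
  /-- (A3) `u'` tends to `0` at `±∞`. -/
  growth_deriv_top : Tendsto (deriv (growthRatio V)) atTop (𝓝 0)
  growth_deriv_bot : Tendsto (deriv (growthRatio V)) atBot (𝓝 0)

/-- The phase space; the coordinates `0, 1, 2, 3` are `φ, x, y, z`. -/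
abbrev Phase : Type := EuclideanSpace ℝ (Fin 4)

/-- The constant `α = (4 - 3γ) / √6`. -/
def alpha (γ : ℝ) : ℝ := (4 - 3 * γ) / Real.sqrt 6

/-- The right-hand side of the transformed system. -/
def field (V : ℝ → ℝ) (γ : ℝ) (p : Phase) : Phase :=
  !₂[-(p 2),
     -(1 / 2) * p 1 * ((p 2) ^ 2 + γ * (p 3) ^ 2),
     deriv V (p 0) * (p 1) ^ 2 + 3 * p 2 - (1 / 2) * (p 2) ^ 3
       - (p 3) ^ 2 * (alpha γ + γ / 2 * p 2),
     -(1 / 2) * p 3 * ((p 2) ^ 2 - alpha γ * p 2 + γ * ((p 3) ^ 2 - 3))]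

/-- The collapsing states: `V(φ) x² + y² / 2 + z² = 3` and `x < 0`. This is a
three-dimensional submanifold of the phase space. -/
def collapsing (V : ℝ → ℝ) : Set Phase :=
  {p | V (p 0) * (p 1) ^ 2 + (1 / 2) * (p 2) ^ 2 + (p 3) ^ 2 = 3 ∧ p 1 < 0}

/-- The interval `[0, T)`, for `T` real or `+∞`. -/
def forwardInterval (T : EReal) : Set ℝ := {τ | 0 ≤ τ ∧ (τ : EReal) < T}

/-- `c` solves `c' = F(c)` on `[0, T)`. -/
def IsForwardSolution (F : Phase → Phase) (c : ℝ → Phase) (T : EReal) : Prop :=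
  0 < T ∧ ∀ τ ∈ forwardInterval T, HasDerivWithinAt c (F (c τ)) (forwardInterval T) τ

/-- `c` solves `c' = F(c)` on `[0, T)`, and this is its maximal right interval of definition:
no solution on a longer interval extends it. -/
def IsMaximalForwardSolution (F : Phase → Phase) (c : ℝ → Phase) (T : EReal) : Prop :=
  IsForwardSolution F c T ∧
    ∀ (T' : EReal) (d : ℝ → Phase), T < T' → IsForwardSolution F d T' →
      ¬ EqOn c d (forwardInterval T)

/-- The filter `τ → T⁻` on the real line, for `T` real or `+∞`. -/
def towardsEnd (T : EReal) : Filter ℝ := comap (fun τ : ℝ => (τ : EReal)) (𝓝[<] T)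

end ScalarCollapse

end

/-! The constraint minus 3 and `x` both satisfy homogeneous linear equations along a solution, so
the constraint and the sign of `x` persist. Suppose the upper limit of `|φ|` is finite. Then `φ` is
bounded on the whole interval; `x < 0` is nondecreasing, hence bounded, and the constraint bounds
`y` and `z`. A maximal solution in a compact set is global (`IsMaximalForwardSolution.eq_top`), so
it suffices that almost no state has a global orbit with `φ` and `x` bounded
(`hausdorffMeasure_bounded_orbit_eq_zero`).

The engine is Liouville's formula. If `div X + ℓ(X)` is at least a positive constant on a compact
set `K`, with `ℓ` linear, the flow expands the volume with density `exp ℓ` exponentially. The points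
that never leave `K` are mapped injectively into `K` at all times, so they form a null set
(`volume_stay_eq_zero`). Locally Lipschitz parametrizations carry this to the surface measure.

By monotonicity `x` either stays away from zero or tends to zero. If it stays away, the coordinates
`(φ, Y, Z) = (φ, y/x, z/x)` confine the orbit to a compact set. The divergence there is `3 + 3γ/2 +
αxY/2`; since `φ' = -xY`, the weight `ℓ = αφ/2` turns it into the constant `3 + 3γ/2`. If `x → 0`
and `α ≠ 0`, then `y' ≈ (3 - y²/2)((1 - γ/2)y - α)` has a definite sign near `y = 0`. Thus `y` is
eventually of one sign and bounded away from zero, and `φ' = -y` makes `φ` unbounded: no such orbit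
exists. If `x → 0` and `α = 0`, that is `γ = 4/3`, the equation `y' ≈ (3 - y²/2)y/3` is repelling at
zero, so bounded `φ` forces `|y| < 1/2`. The points `x = y = 0` are saddles with rates `-2` and `1`.
The substitution `x = -s⁴` weakens the contraction to `-1/2`, the divergence becomes positive, and
the volume argument applies again. States reaching this regime later are pulled back by the flow,
which is Lipschitz on compact sets. -/

namespace ScalarCollapse

/-! ### Flows of compactly supported fields and their derivatives in the initial point. -/

section Flow

open scoped NNReal Manifold

variable {E : Type*} [NormedAddCommGroup E] [NormedSpace ℝ E]

/-- A compactly supported `C¹` vector field is complete. -/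
theorem exists_global_flow [FiniteDimensional ℝ E] {X : E → E} (hX : ContDiff ℝ 1 X) (hc : HasCompactSupport X) :
    ∃ Φ : E → ℝ → E, ∀ p, Φ p 0 = p ∧ ∀ t, HasDerivAt (Φ p) (X (Φ p t)) t := by
  have : CompleteSpace E := FiniteDimensional.complete ℝ E
  obtain ⟨C, hC⟩ := hc.exists_bound_of_continuous hX.continuous
  obtain ⟨K, hK⟩ := ContDiff.lipschitzWith_of_hasCompactSupport hc hX one_ne_zero
  set B : ℝ≥0 := ⟨max C 1, le_trans zero_le_one (le_max_right _ _)⟩ with hB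
  have hB1 : (1 : ℝ) ≤ B := le_max_right _ _
  have hB0 : (0 : ℝ) < B := by linarith
  have hv : ContMDiff 𝓘(ℝ, E) (𝓘(ℝ, E)).tangent 1
      (fun x ↦ (⟨x, X x⟩ : TangentBundle 𝓘(ℝ, E) E)) :=
    contMDiff_vectorSpace_iff_contDiff.2 hX
  have key : ∀ x : E, ∃ γ : ℝ → E, γ 0 = x ∧ IsMIntegralCurve (I := 𝓘(ℝ, E)) γ X := by
    -- `B` bounds `X` everywhere, so on a ball of radius 1 about any point Picard–Lindelöf gives the
    -- lifespan `1 / B`, independent of the point; uniform local existence yields global existence.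
    refine exists_isMIntegralCurve_of_isMIntegralCurveOn hv (ε := 1 / B) (by positivity) ?_
    intro x
    have hmem : (0 : ℝ) ∈ Icc (-(1 / (B : ℝ))) (1 / B) := by
      constructor
      · simp
      · positivity
    have hpl : IsPicardLindelof (fun _ => X) (⟨0, hmem⟩ : Icc (-(1 / (B : ℝ))) (1 / B)) x 1 0 B K := by
      refine IsPicardLindelof.of_time_independent ?_ hK.lipschitzOnWith ?_
      · intro y _
        exact (hC y).trans (le_max_left _ _)
      · simp
        rw [mul_inv_cancel₀ hB0.ne']
    obtain ⟨α, hα0, hα⟩ := hpl.exists_eq_forall_mem_Icc_hasDerivWithinAt₀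
    refine ⟨α, hα0, ?_⟩
    intro t ht
    have h1 := (hα t (Ioo_subset_Icc_self ht)).hasDerivAt (Icc_mem_nhds ht.1 ht.2)
    exact (h1.hasFDerivAt.hasMFDerivAt).hasMFDerivWithinAt
  choose Φ hΦ0 hΦ using key
  refine ⟨Φ, fun p => ⟨hΦ0 p, fun t => ?_⟩⟩
  have h : HasFDerivAt (Φ p) ((1 : ℝ →L[ℝ] ℝ).smulRight (X (Φ p t))) t :=
    hasMFDerivAt_iff_hasFDerivAt.1 (hΦ p t)
  simpa using h.hasDerivAt

variable {X : E → E} {Φ : E → ℝ → E} {K : ℝ≥0}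

theorem flow_add (hK : LipschitzWith K X)
    (hΦ : ∀ p, Φ p 0 = p ∧ ∀ t, HasDerivAt (Φ p) (X (Φ p t)) t) (p : E) (s t : ℝ) :
    Φ p (s + t) = Φ (Φ p s) t := by
  have h : (fun t => Φ p (s + t)) = Φ (Φ p s) := by
    refine ODE_solution_unique_univ (v := fun _ => X) (s := fun _ => univ) (K := K) (t₀ := 0)
      (fun _ => hK.lipschitzOnWith) (fun t => ⟨?_, mem_univ _⟩)
      (fun t => ⟨(hΦ _).2 t, mem_univ _⟩) ?_
    · exact ((hΦ p).2 (s + t)).comp_const_add s t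
    · simp [(hΦ (Φ p s)).1]
  exact congrFun h t

theorem flow_injective (hK : LipschitzWith K X)
    (hΦ : ∀ p, Φ p 0 = p ∧ ∀ t, HasDerivAt (Φ p) (X (Φ p t)) t) (t : ℝ) :
    Function.Injective (fun p => Φ p t) := by
  intro p q hpq
  have h : Φ p = Φ q :=
    ODE_solution_unique_univ (v := fun _ => X) (s := fun _ => univ) (K := K) (t₀ := t)
      (fun _ => hK.lipschitzOnWith) (fun t => ⟨(hΦ _).2 t, mem_univ _⟩)
      (fun t => ⟨(hΦ _).2 t, mem_univ _⟩) hpq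
  rw [← (hΦ p).1, ← (hΦ q).1, h]

theorem norm_flow_sub_le (hK : LipschitzWith K X)
    (hΦ : ∀ p, Φ p 0 = p ∧ ∀ t, HasDerivAt (Φ p) (X (Φ p t)) t) (p q : E) {t : ℝ} (ht : 0 ≤ t) :
    ‖Φ p t - Φ q t‖ ≤ ‖p - q‖ * Real.exp (K * t) := by
  have h := dist_le_of_trajectories_ODE (v := fun _ => X) (K := K) (f := Φ p) (g := Φ q)
    (a := 0) (b := t) (δ := ‖p - q‖)
    (fun _ => hK) (fun s _ => ((hΦ p).2 s).continuousAt.continuousWithinAt)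
    (fun s _ => ((hΦ p).2 s).hasDerivWithinAt)
    (fun s _ => ((hΦ q).2 s).continuousAt.continuousWithinAt)
    (fun s _ => ((hΦ q).2 s).hasDerivWithinAt)
    (by rw [(hΦ p).1, (hΦ q).1, dist_eq_norm]) t ⟨ht, le_rfl⟩
  rwa [dist_eq_norm, sub_zero] at h

/-- The first-order Taylor estimate of a compactly supported `C¹` map is uniform. -/
theorem uniform_linearization (hX : ContDiff ℝ 1 X) (hc : HasCompactSupport X) {ε : ℝ}
    (hε : 0 < ε) : ∃ δ > 0, ∀ a b, ‖b - a‖ < δ →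
      ‖X b - X a - fderiv ℝ X a (b - a)‖ ≤ ε * ‖b - a‖ := by
  have hu : UniformContinuous (fderiv ℝ X) :=
    (hX.continuous_fderiv one_ne_zero).uniformContinuous_of_tendsto_cocompact
      (hc.fderiv ℝ).is_zero_at_infty
  obtain ⟨δ, hδ, h⟩ := Metric.uniformContinuous_iff.1 hu ε hε
  refine ⟨δ, hδ, fun a b hab => ?_⟩
  refine (convex_ball a δ).norm_image_sub_le_of_norm_fderiv_le' (𝕜 := ℝ) (f := X)
    (fun x _ => (hX.differentiable one_ne_zero) x) (fun x hx => ?_) (Metric.mem_ball_self hδ)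
    (by rwa [Metric.mem_ball, dist_eq_norm])
  have := h (Metric.mem_ball.1 hx)
  rw [dist_eq_norm] at this
  exact this.le

/-- For short times the flow is differentiable in the initial point, and its derivative solves
the variational equation. -/
theorem exists_hasFDerivAt_flow [FiniteDimensional ℝ E] (hX : ContDiff ℝ 1 X) (hc : HasCompactSupport X)
    (hΦ : ∀ p, Φ p 0 = p ∧ ∀ t, HasDerivAt (Φ p) (X (Φ p t)) t) :
    ∃ σ > 0, ∀ p, ∃ M : ℝ → E →L[ℝ] E, M 0 = ContinuousLinearMap.id ℝ E ∧
      (∀ t ∈ Icc 0 σ,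
        HasDerivWithinAt M ((fderiv ℝ X (Φ p t)).comp (M t)) (Icc 0 σ) t) ∧
      ∀ t ∈ Icc 0 σ, HasFDerivAt (fun q => Φ q t) (M t) p := by
  have : CompleteSpace E := FiniteDimensional.complete ℝ E
  obtain ⟨C, hC⟩ := (hc.fderiv ℝ).exists_bound_of_continuous (hX.continuous_fderiv one_ne_zero)
  obtain ⟨K, hK⟩ := ContDiff.lipschitzWith_of_hasCompactSupport hc hX one_ne_zero
  set B : ℝ≥0 := ⟨max C 1, le_trans zero_le_one (le_max_right _ _)⟩ with hB
  have hB1 : (1 : ℝ) ≤ B := le_max_right _ _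
  have hB0 : (0 : ℝ) < B := by linarith
  have hCB : ∀ x, ‖fderiv ℝ X x‖ ≤ B := fun x => (hC x).trans (le_max_left _ _)
  -- In the unit ball about the identity `‖M‖ ≤ 2`, so the variational field is bounded by `2 * B`.
  -- The resulting time does not depend on `p`, which allows short steps to be composed later.
  refine ⟨1 / (2 * B), by positivity, fun p => ?_⟩
  set σ : ℝ := 1 / (2 * B) with hσ
  have hσ0 : 0 < σ := by positivity
  have hcont : Continuous (Φ p) :=
    continuous_iff_continuousAt.2 fun t => ((hΦ p).2 t).continuousAt
  have hDc : Continuous fun t => fderiv ℝ X (Φ p t) :=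
    (hX.continuous_fderiv one_ne_zero).comp hcont
  have hpl : IsPicardLindelof (fun t (M : E →L[ℝ] E) => (fderiv ℝ X (Φ p t)).comp M)
      (⟨0, ⟨le_rfl, hσ0.le⟩⟩ : Icc (0 : ℝ) σ) (ContinuousLinearMap.id ℝ E) 1 0 (2 * B) B := by
    refine ⟨?_, ?_, ?_, ?_⟩
    · intro t _
      refine LipschitzOnWith.of_dist_le_mul fun M _ N _ => ?_
      rw [dist_eq_norm, dist_eq_norm, ← ContinuousLinearMap.comp_sub]
      exact (ContinuousLinearMap.opNorm_comp_le _ _).trans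
        (mul_le_mul_of_nonneg_right (hCB _) (norm_nonneg _))
    · intro M _
      exact (hDc.clm_comp continuous_const).continuousOn
    · intro t _ M hM
      have h1 : ‖M‖ ≤ 2 := by
        have h2 : ‖M - ContinuousLinearMap.id ℝ E‖ ≤ 1 := by
          simpa [dist_eq_norm] using hM
        calc ‖M‖ = ‖(M - ContinuousLinearMap.id ℝ E) + ContinuousLinearMap.id ℝ E‖ := by
              rw [sub_add_cancel]
          _ ≤ ‖M - ContinuousLinearMap.id ℝ E‖ + ‖ContinuousLinearMap.id ℝ E‖ := norm_add_le _ _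
          _ ≤ 1 + 1 := add_le_add h2 ContinuousLinearMap.norm_id_le
          _ = 2 := by norm_num
      calc ‖(fderiv ℝ X (Φ p t)).comp M‖ ≤ ‖fderiv ℝ X (Φ p t)‖ * ‖M‖ :=
            ContinuousLinearMap.opNorm_comp_le _ _
        _ ≤ B * 2 := mul_le_mul (hCB _) h1 (norm_nonneg _) hB0.le
        _ = ((2 * B : ℝ≥0) : ℝ) := by push_cast; ring
    · have : max (σ - 0) (0 - 0) = σ := by simp [hσ0.le]
      simp only [this]
      push_cast
      rw [hσ]
      field_simp
      norm_num
  obtain ⟨M, hM0, hM⟩ := hpl.exists_eq_forall_mem_Icc_hasDerivWithinAt₀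
  refine ⟨M, hM0, hM, fun t ht => ?_⟩
  refine HasFDerivAt.of_isLittleO ?_
  rw [Asymptotics.isLittleO_iff]
  intro c hc0
  set S : ℝ := Real.exp (K * σ) with hS
  set G : ℝ := Real.exp (B * σ) with hG
  have hS0 : 0 < S := Real.exp_pos _
  have hG0 : 0 < G := Real.exp_pos _
  -- `S` bounds the spreading of orbits and `G` the Grönwall factor; dividing by both leaves exactly
  -- `c * ‖q - p‖` at the end.
  obtain ⟨δ, hδ, hlin⟩ := uniform_linearization hX hc (ε := c / (S * G)) (by positivity)
  filter_upwards [Metric.ball_mem_nhds p (show 0 < δ / S by positivity)] with q hq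
  rw [Metric.mem_ball, dist_eq_norm, lt_div_iff₀ hS0] at hq
  have hdist : ∀ u ∈ Icc 0 σ, ‖Φ q u - Φ p u‖ ≤ ‖q - p‖ * S := fun u hu =>
    (norm_flow_sub_le hK hΦ q p hu.1).trans
      (mul_le_mul_of_nonneg_left (Real.exp_le_exp.2
        (mul_le_mul_of_nonneg_left hu.2 K.coe_nonneg)) (norm_nonneg _))
  have hMv : ∀ u ∈ Icc 0 σ, HasDerivWithinAt (fun u => M u (q - p))
      (fderiv ℝ X (Φ p u) (M u (q - p))) (Icc 0 σ) u := fun u hu =>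
    ((ContinuousLinearMap.apply ℝ E (q - p)).hasFDerivAt (x := M u)).comp_hasDerivWithinAt u (hM u hu)
  have hder : ∀ u ∈ Icc 0 σ, HasDerivWithinAt (fun u => Φ q u - Φ p u - M u (q - p))
      (X (Φ q u) - X (Φ p u) - fderiv ℝ X (Φ p u) (M u (q - p))) (Icc 0 σ) u := fun u hu =>
    (((hΦ q).2 u).hasDerivWithinAt.sub ((hΦ p).2 u).hasDerivWithinAt).sub (hMv u hu)
  have hgr := norm_le_gronwallBound_of_norm_deriv_right_le (δ := 0) (K := B)
    (ε := c / (S * G) * (‖q - p‖ * S)) (a := 0) (b := σ)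
    (fun u hu => (hder u hu).continuousWithinAt)
    (fun u hu => (hder u ⟨hu.1, hu.2.le⟩).mono_of_mem_nhdsWithin
      (Icc_mem_nhdsGE_of_mem hu)) (by simp [hM0, (hΦ q).1, (hΦ p).1])
    (fun u hu => by
      have hu' : u ∈ Icc 0 σ := ⟨hu.1, hu.2.le⟩
      have h1 := hlin (Φ p u) (Φ q u) ((hdist u hu').trans_lt hq)
      -- The remainder solves the variational equation up to the Taylor error of `X`, which is the
      -- form required by Grönwall's inequality.
      have h2 : X (Φ q u) - X (Φ p u) - fderiv ℝ X (Φ p u) (M u (q - p)) =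
          (X (Φ q u) - X (Φ p u) - fderiv ℝ X (Φ p u) (Φ q u - Φ p u)) +
            fderiv ℝ X (Φ p u) (Φ q u - Φ p u - M u (q - p)) := by
        simp only [map_sub]; abel
      rw [h2, add_comm (_ * _ : ℝ)]
      refine (norm_add_le _ _).trans (add_le_add (h1.trans ?_) ?_)
      · exact mul_le_mul_of_nonneg_left (hdist u hu') (by positivity)
      · exact (ContinuousLinearMap.le_opNorm _ _).trans
          (mul_le_mul_of_nonneg_right (hCB _) (norm_nonneg _))) t ht
  refine hgr.trans ?_
  rw [gronwallBound_of_K_ne_0 hB0.ne', sub_zero]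
  have h3 : c / (S * G) * (‖q - p‖ * S) = c * ‖q - p‖ / G := by field_simp
  have h4 : Real.exp (B * t) ≤ G := Real.exp_le_exp.2 (mul_le_mul_of_nonneg_left ht.2 hB0.le)
  simp only [h3, zero_mul, zero_add]
  calc c * ‖q - p‖ / G / B * (Real.exp (B * t) - 1) ≤ c * ‖q - p‖ / G / 1 * G := by
        gcongr
        · linarith [Real.exp_pos (B * t), Real.one_le_exp (mul_nonneg hB0.le ht.1)]
        · linarith
    _ = c * ‖q - p‖ := by field_simp

end Flow

/-! ### Divergence and Liouville's formula. -/

section Volume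

open scoped NNReal

/-- The divergence of a vector field on `ℝ³`. -/
noncomputable def divergence (X : (Fin 3 → ℝ) → Fin 3 → ℝ) (p : Fin 3 → ℝ) : ℝ :=
  ∑ i, fderiv ℝ X p (Pi.single i 1) i

theorem continuous_divergence {X : (Fin 3 → ℝ) → Fin 3 → ℝ} (hX : ContDiff ℝ 1 X) :
    Continuous (divergence X) := by
  refine continuous_finsetSum _ fun i _ => ?_
  exact (continuous_apply i).comp ((hX.continuous_fderiv one_ne_zero).clm_apply continuous_const)

/-- Liouville's formula for a linear differential equation on `ℝ³`. -/
theorem hasDerivWithinAt_det {M : ℝ → (Fin 3 → ℝ) →L[ℝ] Fin 3 → ℝ}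
    {A : (Fin 3 → ℝ) →L[ℝ] Fin 3 → ℝ} {s : Set ℝ} {t : ℝ}
    (hM : HasDerivWithinAt M (A.comp (M t)) s t) :
    HasDerivWithinAt (fun u => (M u).det) ((∑ i, A (Pi.single i 1) i) * (M t).det) s t := by
  have hdet : ∀ L : (Fin 3 → ℝ) →L[ℝ] Fin 3 → ℝ,
      L.det = (Matrix.of fun i j => L (Pi.single j 1) i).det := by
    intro L
    rw [ContinuousLinearMap.det, ← LinearMap.det_toMatrix']
    congr 1
  have hentry : ∀ i j, HasDerivWithinAt (fun u => M u (Pi.single j 1) i)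
      (∑ k, A (Pi.single k 1) i * M t (Pi.single j 1) k) s t := by
    intro i j
    have h1 : HasDerivWithinAt (fun u => M u (Pi.single j 1)) (A (M t (Pi.single j 1))) s t :=
      ((ContinuousLinearMap.apply ℝ (Fin 3 → ℝ) (Pi.single j 1)).hasFDerivAt
        (x := M t)).comp_hasDerivWithinAt t hM
    have h2 := (hasDerivWithinAt_pi.1 h1) i
    refine h2.congr_deriv ?_
    conv_lhs => rw [pi_eq_sum_univ' (M t (Pi.single j 1))]
    simp [Finset.sum_apply, mul_comm]
  simp only [hdet, Matrix.det_fin_three, Matrix.of_apply]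
  have h := hentry
  simp only [Fin.sum_univ_three] at h ⊢
  refine ((((((h 0 0).mul (h 1 1)).mul (h 2 2)).sub (((h 0 0).mul (h 1 2)).mul (h 2 1))).sub
    (((h 0 1).mul (h 1 0)).mul (h 2 2))).add (((h 0 1).mul (h 1 2)).mul (h 2 0))).add
    (((h 0 2).mul (h 1 0)).mul (h 2 1)) |>.sub (((h 0 2).mul (h 1 1)).mul (h 2 0)) |>.congr_deriv ?_
  simp only [Pi.mul_apply]
  ring

end Volume

/-! ### Volume expansion and null sets of confined orbits. -/

section Volume

open scoped NNReal

variable {X : (Fin 3 → ℝ) → Fin 3 → ℝ} {Φ : (Fin 3 → ℝ) → ℝ → Fin 3 → ℝ}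

/-- The determinant of the derivative of the flow grows exponentially, up to the weight `exp ℓ`,
while the orbit stays where the weighted divergence is bounded below. -/
theorem exp_le_det_of_divergence (hX : ContDiff ℝ 1 X)
    (hΦ : ∀ p, Φ p 0 = p ∧ ∀ t, HasDerivAt (Φ p) (X (Φ p t)) t) {c σ : ℝ}
    (ℓ : (Fin 3 → ℝ) →L[ℝ] ℝ) {p : Fin 3 → ℝ} {M : ℝ → (Fin 3 → ℝ) →L[ℝ] Fin 3 → ℝ}
    (hM0 : M 0 = ContinuousLinearMap.id ℝ _)
    (hM : ∀ t ∈ Icc 0 σ,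
      HasDerivWithinAt M ((fderiv ℝ X (Φ p t)).comp (M t)) (Icc 0 σ) t)
    (hdiv : ∀ t, 0 ≤ t → c ≤ divergence X (Φ p t) + ℓ (X (Φ p t))) {t : ℝ} (ht : t ∈ Icc 0 σ) :
    Real.exp (c * t + ℓ p - ℓ (Φ p t)) ≤ (M t).det := by
  have hcont : Continuous (Φ p) :=
    continuous_iff_continuousAt.2 fun t => ((hΦ p).2 t).continuousAt
  have hk : Continuous fun u => divergence X (Φ p u) := (continuous_divergence hX).comp hcont
  set I : ℝ → ℝ := fun u => ∫ v in (0 : ℝ)..u, divergence X (Φ p v) with hI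
  have hI' : ∀ u, HasDerivAt I (divergence X (Φ p u)) u := fun u =>
    intervalIntegral.integral_hasDerivAt_right (hk.intervalIntegrable _ _)
      (hk.stronglyMeasurableAtFilter _ _) hk.continuousAt
  -- By Liouville's formula the determinant times `exp (-∫ div)` is constant.
  have hdet : ∀ u ∈ Icc 0 σ, HasDerivWithinAt (fun u => (M u).det * Real.exp (-I u)) 0
      (Icc 0 σ) u := by
    intro u hu
    have h1 := hasDerivWithinAt_det (hM u hu)
    have h2 := ((hI' u).neg.exp).hasDerivWithinAt (s := Icc 0 σ)
    refine (h1.mul h2).congr_deriv ?_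
    simp only [divergence, Pi.neg_apply]
    ring
  have hconst : (M t).det * Real.exp (-I t) = 1 := by
    have := constant_of_has_deriv_right_zero (a := 0) (b := σ)
      (fun u hu => (hdet u hu).continuousWithinAt)
      (fun u hu => (hdet u ⟨hu.1, hu.2.le⟩).mono_of_mem_nhdsWithin
        (Icc_mem_nhdsGE_of_mem hu)) t ht
    rw [this, hM0]
    simp [hI, ContinuousLinearMap.det]
  have hdetI : (M t).det = Real.exp (I t) := by
    rw [Real.exp_neg] at hconst
    field_simp at hconst
    exact hconst
  rw [hdetI]
  apply Real.exp_le_exp.2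
  have hF : ∀ u, HasDerivAt (fun u => I u + ℓ (Φ p u) - c * u)
      (divergence X (Φ p u) + ℓ (X (Φ p u)) - c * 1) u := fun u =>
    ((hI' u).add (ℓ.hasFDerivAt.comp_hasDerivAt u ((hΦ p).2 u))).sub
      ((hasDerivAt_id u).const_mul c)
  -- Integrated form of the lower bound on the weighted divergence.
  have hmono : MonotoneOn (fun u => I u + ℓ (Φ p u) - c * u) (Ici 0) := by
    refine monotoneOn_of_deriv_nonneg (convex_Ici 0)
      (fun u _ => (hF u).continuousAt.continuousWithinAt)
      (fun u _ => (hF u).differentiableAt.differentiableWithinAt) fun u hu => ?_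
    rw [interior_Ici] at hu
    rw [(hF u).deriv]
    linarith [hdiv u (le_of_lt hu)]
  have := hmono (mem_Ici.2 le_rfl) (mem_Ici.2 ht.1) ht.1
  simp only [(hΦ p).1, mul_zero, sub_zero] at this
  have hI0 : I 0 = 0 := by simp [hI]
  linarith

/-- In a compact set on which the weighted divergence is bounded below by a positive constant,
only a null set of points stays for ever. -/
theorem volume_stay_eq_zero_of_hasCompactSupport (hX : ContDiff ℝ 1 X) (hc : HasCompactSupport X)
    (hΦ : ∀ p, Φ p 0 = p ∧ ∀ t, HasDerivAt (Φ p) (X (Φ p t)) t) {K : Set (Fin 3 → ℝ)}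
    (hK : IsCompact K) {c : ℝ} (hc0 : 0 < c) (ℓ : (Fin 3 → ℝ) →L[ℝ] ℝ)
    (hdiv : ∀ p ∈ K, c ≤ divergence X p + ℓ (X p)) :
    volume {p | ∀ t, 0 ≤ t → Φ p t ∈ K} = 0 := by
  obtain ⟨L, hL⟩ := ContDiff.lipschitzWith_of_hasCompactSupport hc hX one_ne_zero
  obtain ⟨σ, hσ, hder⟩ := exists_hasFDerivAt_flow hX hc hΦ
  set A : Set (Fin 3 → ℝ) := {p | ∀ t, 0 ≤ t → Φ p t ∈ K} with hA
  have hAK : A ⊆ K := fun p hp => by simpa [(hΦ p).1] using hp 0 le_rfl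
  have hshift : ∀ p ∈ A, ∀ t, 0 ≤ t → Φ p t ∈ A := fun p hp t ht s hs => by
    rw [← flow_add hL hΦ]
    exact hp _ (add_nonneg ht hs)
  have hcontp : ∀ t, 0 ≤ t → Continuous fun p => Φ p t := by
    intro t ht
    refine (LipschitzWith.of_dist_le_mul (K := (Real.exp (L * t)).toNNReal) fun p q => ?_).continuous
    rw [dist_eq_norm, dist_eq_norm, Real.coe_toNNReal _ (Real.exp_pos _).le, mul_comm]
    exact norm_flow_sub_le hL hΦ p q ht
  have hAclosed : IsClosed A := by
    have : A = ⋂ t ∈ Ici (0 : ℝ), (fun p => Φ p t) ⁻¹' K := by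
      ext p; simp [hA]
    rw [this]
    exact isClosed_biInter fun t ht => hK.isClosed.preimage (hcontp t ht)
  -- The flow is known to be differentiable only up to time `σ`. Longer times come from the chain
  -- rule; determinants multiply and the weights `ℓ` telescope to their endpoint values.
  have hstep : ∀ n : ℕ, ∀ p ∈ A, ∃ M : (Fin 3 → ℝ) →L[ℝ] Fin 3 → ℝ,
      HasFDerivAt (fun q => Φ q (n * σ)) M p ∧
        Real.exp (c * (n * σ) + ℓ p - ℓ (Φ p (n * σ))) ≤ M.det := by
    intro n
    induction n with
    | zero =>
      intro p _
      refine ⟨ContinuousLinearMap.id ℝ _, ?_, ?_⟩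
      · have : (fun q => Φ q ((0 : ℕ) * σ)) = id := by
          ext q; simp [(hΦ q).1]
        rw [this]
        exact hasFDerivAt_id p
      · simp [(hΦ p).1, ContinuousLinearMap.det]
    | succ n ih =>
      intro p hp
      obtain ⟨M, hM, hMdet⟩ := ih p hp
      have hn : (0 : ℝ) ≤ n * σ := by positivity
      have hq := hshift p hp _ hn
      obtain ⟨N, hN0, hN, hN'⟩ := hder (Φ p (n * σ))
      have hσm : σ ∈ Icc 0 σ := ⟨hσ.le, le_rfl⟩
      have hNdet := exp_le_det_of_divergence hX hΦ ℓ hN0 hN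
        (fun t ht => hdiv _ (hq t ht)) hσm
      have hsum : ∀ q, Φ q ((n + 1 : ℕ) * σ) = Φ (Φ q (n * σ)) σ := fun q => by
        rw [← flow_add hL hΦ]; push_cast; ring_nf
      refine ⟨(N σ).comp M, ?_, ?_⟩
      · simp only [hsum]
        exact (hN' σ hσm).comp p hM
      · have hmul : ((N σ).comp M).det = (N σ).det * M.det := by
          simp [ContinuousLinearMap.det, LinearMap.det_comp]
        rw [hmul, hsum]
        calc Real.exp (c * ((n + 1 : ℕ) * σ) + ℓ p - ℓ (Φ (Φ p (n * σ)) σ))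
            = Real.exp (c * σ + ℓ (Φ p (n * σ)) - ℓ (Φ (Φ p (n * σ)) σ)) *
                Real.exp (c * (n * σ) + ℓ p - ℓ (Φ p (n * σ))) := by
              rw [← Real.exp_add]; push_cast; ring_nf
          _ ≤ (N σ).det * M.det :=
              mul_le_mul hNdet hMdet (Real.exp_pos _).le ((Real.exp_pos _).le.trans hNdet)
  obtain ⟨C, hC⟩ := hK.exists_bound_of_continuousOn ℓ.continuous.continuousOn
  -- The two endpoint values of `ℓ` lie in `[-C, C]` because both endpoints are in `K`, so the
  -- weight costs at most the factor `exp (-2C)`, whatever `n` is.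
  have hmeas : ∀ n : ℕ, ENNReal.ofReal (Real.exp (c * (n * σ) - 2 * C)) * volume A ≤ volume K := by
    intro n
    have hn : (0 : ℝ) ≤ n * σ := by positivity
    choose! M hM hMdet using hstep n
    have h1 := lintegral_abs_det_fderiv_eq_addHaar_image volume hAclosed.measurableSet
      (fun p hp => (hM p hp).hasFDerivWithinAt) ((flow_injective hL hΦ (n * σ)).injOn)
    calc ENNReal.ofReal (Real.exp (c * (n * σ) - 2 * C)) * volume A
        = ∫⁻ _ in A, ENNReal.ofReal (Real.exp (c * (n * σ) - 2 * C)) := by simp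
      _ ≤ ∫⁻ p in A, ENNReal.ofReal |(M p).det| := by
          refine setLIntegral_mono' hAclosed.measurableSet fun p hp => ?_
          apply ENNReal.ofReal_le_ofReal
          refine le_trans ?_ ((hMdet p hp).trans (le_abs_self _))
          apply Real.exp_le_exp.2
          have h2 := abs_le.1 (hC p (hAK hp))
          have h3 := abs_le.1 (hC _ (hp _ hn))
          linarith [h2.1, h3.2]
      _ = volume ((fun q => Φ q (n * σ)) '' A) := h1
      _ ≤ volume K := measure_mono (by rintro _ ⟨p, hp, rfl⟩; exact hp _ hn)
  by_contra hne
  have hKfin : volume K ≠ ⊤ := hK.measure_lt_top.ne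
  have hAfin : volume A ≠ ⊤ := ((measure_mono hAK).trans_lt hK.measure_lt_top).ne
  have hpos : 0 < (volume A).toReal := ENNReal.toReal_pos hne hAfin
  have hreal : ∀ n : ℕ, Real.exp (c * (n * σ) - 2 * C) * (volume A).toReal ≤ (volume K).toReal := by
    intro n
    have := ENNReal.toReal_mono hKfin (hmeas n)
    rwa [ENNReal.toReal_mul, ENNReal.toReal_ofReal (Real.exp_pos _).le] at this
  obtain ⟨n, hn⟩ := exists_nat_gt (((volume K).toReal / (volume A).toReal + 2 * C) / (c * σ))
  rw [div_lt_iff₀ (by positivity)] at hn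
  have h1 := Real.add_one_le_exp (c * (n * σ) - 2 * C)
  have h2 := (le_div_iff₀ hpos).2 (hreal n)
  nlinarith

open scoped Manifold in
/-- A `C¹` map on a neighbourhood of a compact set agrees near this set with a compactly supported
`C¹` map. -/
theorem exists_contDiff_hasCompactSupport_eq {E F : Type*} [NormedAddCommGroup E]
    [NormedSpace ℝ E] [FiniteDimensional ℝ E] [NormedAddCommGroup F] [NormedSpace ℝ F]
    {X : E → F} {U K : Set E} (hU : IsOpen U) (hX : ContDiffOn ℝ 1 X U) (hK : IsCompact K)
    (hKU : K ⊆ U) :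
    ∃ Y : E → F, ContDiff ℝ 1 Y ∧ HasCompactSupport Y ∧ ∀ᶠ p in 𝓝ˢ K, Y p = X p := by
  obtain ⟨K', hK', hKK', hK'U⟩ := exists_compact_between hK hU hKU
  obtain ⟨f, hf1, hf0, -⟩ := exists_contMDiffMap_one_nhds_of_subset_interior (n := 1)
    𝓘(ℝ, E) hK.isClosed hKK'
  have hf : ContDiff ℝ 1 f := f.contMDiff.contDiff
  refine ⟨fun p => f p • X p, ?_, ?_, ?_⟩
  · rw [contDiff_iff_contDiffAt]
    intro p
    by_cases hp : p ∈ K'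
    · exact hf.contDiffAt.smul (hX.contDiffAt (hU.mem_nhds (hK'U hp)))
    · have : (fun p => f p • X p) =ᶠ[𝓝 p] fun _ => 0 := by
        filter_upwards [hK'.isClosed.isOpen_compl.mem_nhds hp] with q hq
        rw [hf0 q hq, zero_smul]
      exact contDiffAt_const.congr_of_eventuallyEq this
  · exact HasCompactSupport.intro hK' fun p hp => by rw [hf0 p hp, zero_smul]
  · filter_upwards [hf1] with p hp
    rw [hp, one_smul]

/-- In a compact set on which the weighted divergence of a `C¹` vector field is bounded below by a
positive constant, only a null set of points has a forward orbit that stays for ever. -/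
theorem volume_stay_eq_zero {U K : Set (Fin 3 → ℝ)} (hU : IsOpen U) (hX : ContDiffOn ℝ 1 X U)
    (hK : IsCompact K) (hKU : K ⊆ U) {c : ℝ} (hc0 : 0 < c) (ℓ : (Fin 3 → ℝ) →L[ℝ] ℝ)
    (hdiv : ∀ p ∈ K, c ≤ divergence X p + ℓ (X p)) :
    volume {p | ∃ w : ℝ → Fin 3 → ℝ, w 0 = p ∧
      ∀ t, 0 ≤ t → HasDerivWithinAt w (X (w t)) (Ici 0) t ∧ w t ∈ K} = 0 := by
  obtain ⟨Y, hY, hYc, hYX⟩ := exists_contDiff_hasCompactSupport_eq hU hX hK hKU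
  obtain ⟨Φ, hΦ⟩ := exists_global_flow hY hYc
  obtain ⟨L, hL⟩ := ContDiff.lipschitzWith_of_hasCompactSupport hYc hY one_ne_zero
  -- Agreement near `K`, not merely on it, makes the divergences agree as well.
  have hYX' : ∀ p ∈ K, Y =ᶠ[𝓝 p] X := fun p hp =>
    (eventually_nhdsSet_iff_forall.1 hYX) p hp
  refine measure_mono_null ?_ (volume_stay_eq_zero_of_hasCompactSupport hY hYc hΦ hK hc0 ℓ ?_)
  · rintro p ⟨w, hw0, hw⟩ t ht
    have huniq : EqOn (Φ p) w (Icc 0 t) := by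
      refine ODE_solution_unique (v := fun _ => Y) (K := L) (fun _ => hL)
        (fun u _ => ((hΦ p).2 u).continuousAt.continuousWithinAt)
        (fun u _ => ((hΦ p).2 u).hasDerivWithinAt)
        (fun u hu => (hw u hu.1).1.continuousWithinAt.mono Icc_subset_Ici_self)
        (fun u hu => ?_) (by rw [(hΦ p).1, hw0])
      rw [(hYX' _ (hw u hu.1).2).self_of_nhds]
      exact (hw u hu.1).1.mono (Ici_subset_Ici.2 hu.1)
    rw [huniq ⟨ht, le_rfl⟩]
    exact (hw t ht).2
  · intro p hp
    have h1 := (hYX' p hp).fderiv_eq (𝕜 := ℝ)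
    simpa only [divergence, h1, (hYX' p hp).self_of_nhds] using hdiv p hp

end Volume

/-! ### Transfer to surface measure, and continuation of solutions. -/

section Transfer

open scoped NNReal

/-- A `C¹` map sends a null set inside a compact set of `ℝ³` to a set of vanishing
three-dimensional measure. -/
theorem hausdorffMeasure_image_eq_zero {F : Type*} [NormedAddCommGroup F] [NormedSpace ℝ F]
    [MeasurableSpace F] [BorelSpace F] {Ψ : (Fin 3 → ℝ) → F} {U K A : Set (Fin 3 → ℝ)}
    (hU : IsOpen U) (hΨ : ContDiffOn ℝ 1 Ψ U) (hK : IsCompact K) (hKU : K ⊆ U) (hAK : A ⊆ K)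
    (hA : volume A = 0) : Measure.hausdorffMeasure 3 (Ψ '' A) = 0 := by
  obtain ⟨Y, hY, hYc, hYΨ⟩ := exists_contDiff_hasCompactSupport_eq hU hΨ hK hKU
  obtain ⟨L, hL⟩ := ContDiff.lipschitzWith_of_hasCompactSupport hYc hY one_ne_zero
  have himage : Ψ '' A = Y '' A := image_congr fun p hp => (hYΨ.self_of_nhdsSet p (hAK hp)).symm
  -- The supremum metric on `Fin 3 → ℝ` makes this an equality without a normalizing constant.
  have hvol : (Measure.hausdorffMeasure 3 : Measure (Fin 3 → ℝ)) = volume := by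
    have := hausdorffMeasure_pi_real (ι := Fin 3)
    simpa using this
  rw [himage]
  refine le_antisymm ((hL.hausdorffMeasure_image_le (d := 3) (by norm_num) A).trans ?_) zero_le
  rw [hvol, hA, mul_zero]

variable {E : Type*} [NormedAddCommGroup E] [NormedSpace ℝ E]

/-- A solution that stays in a set on which the field is the restriction of a Lipschitz field
is an orbit of the flow of the latter. -/
theorem eqOn_flow {F Y : E → E} {Φ : E → ℝ → E} {L : ℝ≥0} (hL : LipschitzWith L Y)
    (hΦ : ∀ p, Φ p 0 = p ∧ ∀ t, HasDerivAt (Φ p) (Y (Φ p t)) t) {K : Set E}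
    (hYF : ∀ p ∈ K, Y p = F p) {c : ℝ → E} {b : ℝ}
    (hc : ∀ t ∈ Icc 0 b, HasDerivWithinAt c (F (c t)) (Icc 0 b) t ∧ c t ∈ K) :
    EqOn c (Φ (c 0)) (Icc 0 b) := by
  refine ODE_solution_unique (v := fun _ => Y) (K := L) (fun _ => hL)
    (fun u hu => (hc u hu).1.continuousWithinAt) (fun u hu => ?_)
    (fun u _ => ((hΦ _).2 u).continuousAt.continuousWithinAt)
    (fun u _ => ((hΦ _).2 u).hasDerivWithinAt) (by rw [(hΦ _).1])
  have hu' : u ∈ Icc 0 b := ⟨hu.1, hu.2.le⟩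
  rw [hYF _ (hc u hu').2]
  exact (hc u hu').1.mono_of_mem_nhdsWithin (Icc_mem_nhdsGE_of_mem hu)

/-- The points whose orbit stays in a compact set and lies in a null set at a given later time
form a null set. -/
theorem hausdorffMeasure_preimage_eq_zero [FiniteDimensional ℝ E] [MeasurableSpace E]
    [BorelSpace E] {F : E → E}
    (hF : ContDiff ℝ 1 F) {K A : Set E} (hK : IsCompact K) {d : ℝ} (hd : 0 ≤ d)
    (hA : Measure.hausdorffMeasure d A = 0) {b : ℝ} (hb : 0 ≤ b) :
    Measure.hausdorffMeasure d {p | ∃ c : ℝ → E, c 0 = p ∧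
      (∀ t ∈ Icc 0 b, HasDerivWithinAt c (F (c t)) (Icc 0 b) t ∧ c t ∈ K) ∧ c b ∈ A} = 0 := by
  obtain ⟨Y, hY, hYc, hYF⟩ :=
    exists_contDiff_hasCompactSupport_eq isOpen_univ hF.contDiffOn hK (subset_univ _)
  obtain ⟨Φ, hΦ⟩ := exists_global_flow hY hYc
  obtain ⟨L, hL⟩ := ContDiff.lipschitzWith_of_hasCompactSupport hYc hY one_ne_zero
  -- Time reversal is the flow of `-Y`, so the forward Lipschitz estimate also controls the backward
  -- flow.
  have hΦ' : ∀ p, (fun t => Φ p (-t)) 0 = p ∧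
      ∀ t, HasDerivAt (fun t => Φ p (-t)) ((-Y) (Φ p (-t))) t := fun p =>
    ⟨by simp [(hΦ p).1], fun t => by
      have := ((hΦ p).2 (-t)).scomp t (hasDerivAt_neg t)
      simpa [Function.comp_def] using this⟩
  have hlip : LipschitzWith (Real.exp (L * b)).toNNReal (fun p => Φ p (-b)) := by
    refine LipschitzWith.of_dist_le_mul fun p q => ?_
    rw [dist_eq_norm, dist_eq_norm, Real.coe_toNNReal _ (Real.exp_pos _).le, mul_comm]
    exact norm_flow_sub_le (X := -Y) (Φ := fun p t => Φ p (-t)) hL.neg hΦ' p q hb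
  refine measure_mono_null (t := (fun p => Φ p (-b)) '' A) ?_ ?_
  · rintro p ⟨c, rfl, hc, hcb⟩
    refine ⟨c b, hcb, ?_⟩
    have h1 := eqOn_flow hL hΦ (fun p hp => hYF.self_of_nhdsSet p hp) hc ⟨hb, le_rfl⟩
    simp only
    rw [h1, ← flow_add hL hΦ, add_neg_cancel, (hΦ _).1]
  · refine le_antisymm ((hlip.hausdorffMeasure_image_le hd A).trans ?_) zero_le
    rw [hA, mul_zero]

theorem Icc_subset_forwardInterval {T : EReal} {b : ℝ} (hb : b ∈ forwardInterval T) :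
    Icc 0 b ⊆ forwardInterval T := fun _ ht =>
  ⟨ht.1, (EReal.coe_le_coe_iff.2 ht.2).trans_lt hb.2⟩

theorem forwardInterval_top : forwardInterval ⊤ = Ici 0 := by
  ext t; simp [forwardInterval]

/-- A maximal solution that stays in a compact set is global. -/
theorem IsMaximalForwardSolution.eq_top {F : Phase → Phase} (hF : ContDiff ℝ 1 F)
    {c : ℝ → Phase} {T : EReal} (h : IsMaximalForwardSolution F c T) {K : Set Phase}
    (hK : IsCompact K) (hc : ∀ t ∈ forwardInterval T, c t ∈ K) : T = ⊤ := by
  by_contra hT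
  obtain ⟨⟨hT0, hsol⟩, hmax⟩ := h
  lift T to ℝ using ⟨hT, ((EReal.bot_lt_zero).trans hT0).ne'⟩
  have hT0' : 0 < T := by exact_mod_cast hT0
  have hmem : ∀ t : ℝ, t ∈ forwardInterval (T : EReal) ↔ 0 ≤ t ∧ t < T := fun t => by
    simp [forwardInterval]
  obtain ⟨Y, hY, hYc, hYF⟩ :=
    exists_contDiff_hasCompactSupport_eq isOpen_univ hF.contDiffOn hK (subset_univ _)
  obtain ⟨Φ, hΦ⟩ := exists_global_flow hY hYc
  obtain ⟨L, hL⟩ := ContDiff.lipschitzWith_of_hasCompactSupport hYc hY one_ne_zero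
  have heq : ∀ t, 0 ≤ t → t < T → c t = Φ (c 0) t := fun t ht htT => by
    have hsub := Icc_subset_forwardInterval ((hmem t).2 ⟨ht, htT⟩)
    exact eqOn_flow hL hΦ (fun p hp => hYF.self_of_nhdsSet p hp)
      (fun u hu => ⟨(hsol u (hsub hu)).mono hsub, hc u (hsub hu)⟩) ⟨ht, le_rfl⟩
  have hcont : Continuous (Φ (c 0)) :=
    continuous_iff_continuousAt.2 fun t => ((hΦ _).2 t).continuousAt
  have hTK : Φ (c 0) T ∈ K := by
    have h1 : Tendsto (Φ (c 0)) (𝓝[<] T) (𝓝 (Φ (c 0) T)) := hcont.continuousWithinAt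
    refine hK.isClosed.mem_of_tendsto h1 ?_
    filter_upwards [Ioo_mem_nhdsLT hT0'] with t ht
    rw [← heq t ht.1.le ht.2]
    exact hc t ((hmem t).2 ⟨ht.1.le, ht.2⟩)
  -- The limit point at time `T` is in `K` and the cut-off field equals `F` around it, so the global
  -- orbit of the cut-off field still solves the original equation shortly beyond `T`, against
  -- maximality.
  have hev : ∀ᶠ t in 𝓝 T, Y (Φ (c 0) t) = F (Φ (c 0) t) :=
    hcont.continuousAt.eventually (eventually_nhdsSet_iff_forall.1 hYF _ hTK)
  obtain ⟨ε, hε, hball⟩ := Metric.eventually_nhds_iff.1 hev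
  refine hmax ((T + ε : ℝ) : EReal) (Φ (c 0)) (by exact_mod_cast (by linarith)) ⟨?_, ?_⟩ ?_
  · exact_mod_cast (by linarith : (0 : ℝ) < T + ε)
  · intro t ht
    have ht0 : 0 ≤ t := ht.1
    have htT : t < T + ε := by exact_mod_cast ht.2
    have hYFt : Y (Φ (c 0) t) = F (Φ (c 0) t) := by
      rcases lt_or_ge t T with hlt | hge
      · rw [← heq t ht0 hlt]
        exact hYF.self_of_nhdsSet _ (hc t ((hmem t).2 ⟨ht0, hlt⟩))
      · refine hball ?_
        rw [Real.dist_eq, abs_of_nonneg (by linarith)]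
        linarith
    rw [← hYFt]
    exact ((hΦ _).2 t).hasDerivWithinAt
  · intro t ht
    obtain ⟨h0, h1⟩ := (hmem t).1 ht
    exact heq t h0 h1

end Transfer

/-! ### Scalar comparison arguments. -/

section Scalar

/-- A solution of a scalar linear equation with bounded coefficient that starts negative remains
negative. -/
theorem neg_of_hasDerivWithinAt_mul {f a : ℝ → ℝ} {b B : ℝ}
    (hf : ∀ t ∈ Icc 0 b, HasDerivWithinAt f (a t * f t) (Icc 0 b) t)
    (ha : ∀ t ∈ Icc 0 b, |a t| ≤ B) (h0 : f 0 < 0) : ∀ t ∈ Icc 0 b, f t < 0 := by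
  have hcont : ContinuousOn f (Icc 0 b) := fun t ht => (hf t ht).continuousWithinAt
  have hexp : ∀ t, HasDerivAt (fun t => Real.exp (2 * B * t)) (Real.exp (2 * B * t) * (2 * B)) t :=
    fun t => by simpa using ((hasDerivAt_id t).const_mul (2 * B)).exp
  have hg : ∀ t ∈ Icc 0 b, HasDerivWithinAt (fun t => f t * f t * Real.exp (2 * B * t))
      (2 * (a t + B) * (f t * f t) * Real.exp (2 * B * t)) (Icc 0 b) t := fun t ht =>
    (((hf t ht).mul (hf t ht)).mul (hexp t).hasDerivWithinAt).congr_deriv (by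
      simp only [Pi.mul_apply]; ring)
  -- The exponential compensates the fastest possible decay of `f²`, so `f` cannot reach zero and
  -- hence cannot change sign.
  have hmono : MonotoneOn (fun t => f t * f t * Real.exp (2 * B * t)) (Icc 0 b) := by
    refine monotoneOn_of_hasDerivWithinAt_nonneg (convex_Icc 0 b)
      (f' := fun t => 2 * (a t + B) * (f t * f t) * Real.exp (2 * B * t))
      (fun t ht => (hg t ht).continuousWithinAt)
      (fun t ht => (hg t (interior_subset ht)).mono interior_subset) fun t ht => ?_
    have h1 := (abs_le.1 (ha t (interior_subset ht))).1
    exact mul_nonneg (mul_nonneg (by linarith) (mul_self_nonneg _)) (Real.exp_pos _).le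
  have hne : ∀ t ∈ Icc 0 b, f t ≠ 0 := by
    intro t ht hft
    have h1 := hmono ⟨le_rfl, ht.1.trans ht.2⟩ ht ht.1
    simp only [hft, mul_zero, zero_mul, Real.exp_zero, mul_one] at h1
    nlinarith
  intro t ht
  by_contra hcon
  have hivt : (0 : ℝ) ∈ f '' Icc 0 t :=
    intermediate_value_Icc ht.1 (hcont.mono (Icc_subset_Icc_right ht.2))
      ⟨h0.le, not_lt.1 hcon⟩
  obtain ⟨u, hu, hu0⟩ := hivt
  exact hne u ⟨hu.1, hu.2.trans ht.2⟩ hu0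

/-- A barrier argument: at a contact point the slope of `w` is strictly below that of the line, so
the line is never crossed upwards. The choice `k = 0` gives a constant barrier. -/
theorem le_of_boundary {w w' : ℝ → ℝ} {a m k : ℝ} (hw : ContinuousOn w (Ici a))
    (hw' : ∀ t, a ≤ t → HasDerivWithinAt w (w' t) (Ici t) t) {b : ℝ} (ha : w a ≤ m)
    (hbd : ∀ t ∈ Ico a b, w t = m - k * (t - a) → w' t < -k) :
    ∀ t ∈ Icc a b, w t ≤ m - k * (t - a) := fun t ht => by
  refine image_le_of_deriv_right_lt_deriv_boundary (f := w) (f' := w') (a := a) (b := b)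
    (B := fun t => m - k * (t - a)) (B' := fun _ => -k) (hw.mono Icc_subset_Ici_self)
    (fun t ht => hw' t ht.1) (by simpa using ha) (fun t => ?_) hbd ht
  have := (((hasDerivAt_id t).sub_const a).const_mul k).const_sub m
  simpa using this

/-- Otherwise `f` would fall by at least `2N + 1` during a time `(2N + 1) / δ`, which is impossible
inside `[-N, N]`. -/
theorem exists_lt_of_bounded_primitive {f w : ℝ → ℝ} {a N δ : ℝ} (hδ : 0 < δ)
    (hf : ∀ t, a ≤ t → HasDerivWithinAt f (w t) (Ici a) t) (hN : ∀ t, a ≤ t → |f t| ≤ N) :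
    ∃ t, a ≤ t ∧ -δ < w t := by
  by_contra! hcon
  have hN0 : 0 ≤ N := (abs_nonneg _).trans (hN a le_rfl)
  have hb : a ≤ a + (2 * N + 1) / δ := by
    have : 0 ≤ (2 * N + 1) / δ := by positivity
    linarith
  have h1 := image_le_of_deriv_right_le_deriv_boundary (f := f) (f' := w) (a := a)
    (b := a + (2 * N + 1) / δ) (B := fun t => f a - δ * (t - a)) (B' := fun _ => -δ)
    (fun t ht => (hf t ht.1).continuousWithinAt.mono Icc_subset_Ici_self)
    (fun t ht => (hf t ht.1).mono (Ici_subset_Ici.2 ht.1)) (by simp)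
    (by fun_prop)
    (fun t _ => by
      have := (((hasDerivAt_id t).sub_const a).const_mul δ).const_sub (f a)
      simp only [mul_one] at this
      exact this.hasDerivWithinAt) (fun t ht => hcon t ht.1) ⟨hb, le_rfl⟩
  have h2 : δ * (a + (2 * N + 1) / δ - a) = 2 * N + 1 := by field_simp; ring
  simp only [h2] at h1
  have h3 := abs_le.1 (hN a le_rfl)
  have h4 := abs_le.1 (hN _ hb)
  linarith [h3.2, h4.1]

/-- If `w` decreases at a definite rate whenever it is small, its primitive is unbounded. -/
theorem unbounded_primitive_of_decreasing {f w w' : ℝ → ℝ} {a N δ η : ℝ} (hδ : 0 < δ) (hη : 0 < η)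
    (hf : ∀ t, a ≤ t → HasDerivWithinAt f (w t) (Ici a) t)
    (hw : ∀ t, a ≤ t → HasDerivWithinAt w (w' t) (Ici a) t)
    (hdec : ∀ t, a ≤ t → |w t| ≤ δ → w' t ≤ -η) (hN : ∀ t, a ≤ t → |f t| ≤ N) : False := by
  have hcont : ContinuousOn w (Ici a) := fun t ht => (hw t ht).continuousWithinAt
  have hright : ∀ t, a ≤ t → HasDerivWithinAt w (w' t) (Ici t) t := fun t ht =>
    (hw t ht).mono (Ici_subset_Ici.2 ht)
  obtain ⟨t₀, ht₀, hw₀⟩ := exists_lt_of_bounded_primitive (f := fun t => -f t)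
    (w := fun t => -w t) (N := N) hδ (fun t ht => (hf t ht).neg)
    (fun t ht => by rw [abs_neg]; exact hN t ht)
  -- Time for a line of slope `-η / 2` to fall from `δ` to `-δ`; half of the available rate gives
  -- the strict inequality at contact. After `t₁` the level `-δ` is a barrier.
  set t₁ := t₀ + 4 * δ / η with ht₁
  have h01 : t₀ ≤ t₁ := by
    have : 0 ≤ 4 * δ / η := by positivity
    linarith
  have h1 : w t₁ ≤ -δ := by
    have := le_of_boundary (m := δ) (k := η / 2) (b := t₁) (hcont.mono (Ici_subset_Ici.2 ht₀))
      (fun t ht => hright t (ht₀.trans ht)) (by linarith) (fun t ht hwt => ?_) t₁ ⟨h01, le_rfl⟩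
    · have h2 : η / 2 * (t₁ - t₀) = 2 * δ := by rw [ht₁]; field_simp; ring
      linarith
    · have h2 : η / 2 * (t - t₀) ≤ η / 2 * (t₁ - t₀) := by
        have := ht.2.le
        gcongr
      have h3 : η / 2 * (t₁ - t₀) = 2 * δ := by rw [ht₁]; field_simp; ring
      have h4 : 0 ≤ η / 2 * (t - t₀) := mul_nonneg (by linarith) (by linarith [ht.1])
      have := hdec t (ht₀.trans ht.1) (abs_le.2 ⟨by linarith, by linarith⟩)
      linarith
  have ha1 : a ≤ t₁ := ht₀.trans h01
  have h2 : ∀ t, t₁ ≤ t → w t ≤ -δ := fun t ht => by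
    have := le_of_boundary (m := -δ) (k := 0) (b := t) (hcont.mono (Ici_subset_Ici.2 ha1))
      (fun t ht => hright t (ha1.trans ht)) h1 (fun u hu hwu => ?_) t ⟨ht, le_rfl⟩
    · simpa using this
    · have hwu' : w u = -δ := by simpa using hwu
      have := hdec u (ha1.trans hu.1) (by rw [hwu', abs_neg, abs_of_pos hδ])
      linarith
  obtain ⟨t, ht, hwt⟩ := exists_lt_of_bounded_primitive (a := t₁) hδ
    (fun t ht => (hf t (ha1.trans ht)).mono (Ici_subset_Ici.2 ha1))
    (fun t ht => hN t (ha1.trans ht))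
  exact absurd (h2 t ht) (not_le.2 hwt)

/-- If `w` cannot return below the level `δ` once it is above, and its primitive is bounded, then
it is always below. -/
theorem lt_of_bounded_primitive {f w w' : ℝ → ℝ} {a N δ : ℝ} (hδ : 0 < δ)
    (hf : ∀ t, a ≤ t → HasDerivWithinAt f (w t) (Ici a) t)
    (hw : ∀ t, a ≤ t → HasDerivWithinAt w (w' t) (Ici a) t)
    (hinc : ∀ t, a ≤ t → w t = δ → 0 < w' t) (hN : ∀ t, a ≤ t → |f t| ≤ N) :
    ∀ t, a ≤ t → w t < δ := by
  intro t₀ ht₀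
  by_contra! hcon
  have h2 : ∀ t, t₀ ≤ t → -w t ≤ -δ := fun t ht => by
    have := le_of_boundary (w := fun t => -w t) (w' := fun t => -w' t) (m := -δ) (k := 0) (b := t)
      (a := t₀)
      (fun u hu => ((hw u (ht₀.trans hu)).continuousWithinAt.mono (Ici_subset_Ici.2 ht₀)).neg)
      (fun u hu => ((hw u (ht₀.trans hu)).mono (Ici_subset_Ici.2 (ht₀.trans hu))).neg)
      (by linarith) (fun u hu hwu => ?_) t ⟨ht, le_rfl⟩
    · simpa using this
    · have hwu' : w u = δ := by simpa using hwu
      have := hinc u (ht₀.trans hu.1) hwu'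
      linarith
  obtain ⟨t, ht, hwt⟩ := exists_lt_of_bounded_primitive (f := fun t => -f t)
    (w := fun t => -w t) (a := t₀) (N := N) hδ
    (fun t ht => ((hf t (ht₀.trans ht)).mono (Ici_subset_Ici.2 ht₀)).neg)
    (fun t ht => by rw [abs_neg]; exact hN t (ht₀.trans ht))
  exact absurd (h2 t ht) (not_le.2 hwt)

end Scalar

/-! ### The vector field and the invariance of the constraint. -/

section Field

variable {V : ℝ → ℝ} {γ : ℝ}

theorem contDiff_deriv_of_two (hV : ContDiff ℝ 2 V) : ContDiff ℝ 1 (deriv V) :=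
  ((contDiff_succ_iff_deriv (n := 1)).1 (by simpa [one_add_one_eq_two] using hV)).2.2

theorem contDiff_field (hV : ContDiff ℝ 2 V) : ContDiff ℝ 1 (field V γ) := by
  have hV1 : ContDiff ℝ 1 (deriv V) := contDiff_deriv_of_two hV
  rw [contDiff_euclidean]
  intro i
  have hc : ∀ j : Fin 4, ContDiff ℝ 1 fun p : Phase => p j := fun j =>
    (EuclideanSpace.proj (𝕜 := ℝ) j).contDiff
  have h0 := hc 0
  have h1 := hc 1
  have h2 := hc 2
  have h3 := hc 3
  have hd : ContDiff ℝ 1 fun p : Phase => deriv V (p 0) := hV1.comp h0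
  fin_cases i <;> simp [field] <;> fun_prop

theorem hasDerivWithinAt_components {c : ℝ → Phase} {s : Set ℝ} {t : ℝ}
    (h : HasDerivWithinAt c (field V γ (c t)) s t) :
    HasDerivWithinAt (fun t => c t 0) (-(c t 2)) s t ∧
    HasDerivWithinAt (fun t => c t 1)
      (-(1 / 2) * c t 1 * ((c t 2) ^ 2 + γ * (c t 3) ^ 2)) s t ∧
    HasDerivWithinAt (fun t => c t 2)
      (deriv V (c t 0) * (c t 1) ^ 2 + 3 * c t 2 - (1 / 2) * (c t 2) ^ 3
        - (c t 3) ^ 2 * (alpha γ + γ / 2 * c t 2)) s t ∧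
    HasDerivWithinAt (fun t => c t 3)
      (-(1 / 2) * c t 3 * ((c t 2) ^ 2 - alpha γ * c t 2 + γ * ((c t 3) ^ 2 - 3))) s t := by
  have hi : ∀ i : Fin 4, HasDerivWithinAt (fun t => c t i) (field V γ (c t) i) s t := fun i =>
    ((EuclideanSpace.proj (𝕜 := ℝ) i).hasFDerivAt (x := c t)).comp_hasDerivWithinAt t h
  exact ⟨hi 0, hi 1, hi 2, hi 3⟩

/-- The constraint and the sign condition are preserved. -/
theorem mem_collapsing_of_hasDerivWithinAt (hV : Differentiable ℝ V) {c : ℝ → Phase} {b : ℝ}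
    (hc : ∀ t ∈ Icc 0 b, HasDerivWithinAt c (field V γ (c t)) (Icc 0 b) t)
    (h0 : c 0 ∈ collapsing V) : ∀ t ∈ Icc 0 b, c t ∈ collapsing V := by
  have hcont : ContinuousOn c (Icc 0 b) := fun t ht => (hc t ht).continuousWithinAt
  have hci : ∀ i : Fin 4, ContinuousOn (fun t => c t i) (Icc 0 b) := fun i =>
    (EuclideanSpace.proj (𝕜 := ℝ) i).continuous.comp_continuousOn hcont
  have hcoef : ContinuousOn (fun t => (c t 2) ^ 2 + γ * (c t 3) ^ 2) (Icc 0 b) :=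
    ((hci 2).pow 2).add (continuousOn_const.mul ((hci 3).pow 2))
  obtain ⟨B, hB⟩ := isCompact_Icc.exists_bound_of_continuousOn hcoef
  -- The defect `W` of the constraint satisfies `W' = -(y² + γz²) W`, so it vanishes identically
  -- once it vanishes at time zero.
  have hW : ∀ t ∈ Icc 0 b, HasDerivWithinAt
      (fun t => V (c t 0) * (c t 1) ^ 2 + (1 / 2) * (c t 2) ^ 2 + (c t 3) ^ 2 - 3)
      (-((c t 2) ^ 2 + γ * (c t 3) ^ 2) *
        (V (c t 0) * (c t 1) ^ 2 + (1 / 2) * (c t 2) ^ 2 + (c t 3) ^ 2 - 3)) (Icc 0 b) t := by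
    intro t ht
    obtain ⟨hφ, hx, hy, hz⟩ := hasDerivWithinAt_components (hc t ht)
    have hVφ := (hV (c t 0)).hasDerivAt.comp_hasDerivWithinAt t hφ
    refine ((((hVφ.mul (hx.pow 2)).add ((hy.pow 2).const_mul (1 / 2))).add
      (hz.pow 2)).sub_const 3).congr_deriv ?_
    simp only [Function.comp, Pi.pow_apply]
    push_cast
    ring
  have hzero := eq_zero_of_abs_deriv_le_mul_abs_self_of_eq_zero_right (K := B) (a := 0) (b := b)
    (fun t ht => (hW t ht).continuousWithinAt)
    (fun t ht => (hW t ⟨ht.1, ht.2.le⟩).mono_of_mem_nhdsWithin (Icc_mem_nhdsGE_of_mem ht))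
    (by simp only [h0.1, sub_self])
    (fun t ht => by
      rw [norm_mul, norm_neg]
      exact mul_le_mul_of_nonneg_right (hB t ⟨ht.1, ht.2.le⟩) (norm_nonneg _))
  have hneg := neg_of_hasDerivWithinAt_mul (f := fun t => c t 1)
    (a := fun t => -(1 / 2) * ((c t 2) ^ 2 + γ * (c t 3) ^ 2)) (B := B)
    (fun t ht => (hasDerivWithinAt_components (hc t ht)).2.1.congr_deriv (by ring))
    (fun t ht => by
      have := hB t ht
      rw [Real.norm_eq_abs] at this
      rw [abs_mul]
      norm_num
      linarith [abs_nonneg ((c t 2) ^ 2 + γ * (c t 3) ^ 2)]) h0.2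
  exact fun t ht => ⟨sub_eq_zero.1 (hzero t ht), hneg t ht⟩

/-- A global solution in the collapsing set. -/
def IsCollapsingOrbit (V : ℝ → ℝ) (γ : ℝ) (c : ℝ → Phase) : Prop :=
  ∀ t, 0 ≤ t → HasDerivWithinAt c (field V γ (c t)) (Ici 0) t ∧ c t ∈ collapsing V

theorem IsCollapsingOrbit.shift {c : ℝ → Phase} (h : IsCollapsingOrbit V γ c) {b : ℝ}
    (hb : 0 ≤ b) : IsCollapsingOrbit V γ fun t => c (b + t) := fun t ht => by
  refine ⟨?_, (h _ (add_nonneg hb ht)).2⟩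
  have h1 := (h (b + t) (add_nonneg hb ht)).1
  have h2 : HasDerivWithinAt (fun t => b + t) 1 (Ici 0) t :=
    ((hasDerivAt_id t).const_add b).hasDerivWithinAt
  have h3 := h1.scomp t h2 (fun u hu => mem_Ici.2 (add_nonneg hb hu))
  simpa [Function.comp_def] using h3

/-- Since `x < 0` and `γ ≥ 0`, the rate `-x(y² + γz²)/2` is nonnegative. This bounds `|x|` by its
initial value and leaves only two behaviours: `x` away from zero, or `x → 0`. -/
theorem monotoneOn_x {c : ℝ → Phase} {s : Set ℝ} (hs : Convex ℝ s) (hγ : 0 ≤ γ)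
    (h : ∀ t ∈ s, HasDerivWithinAt c (field V γ (c t)) s t ∧ c t ∈ collapsing V) :
    MonotoneOn (fun t => c t 1) s := by
  refine monotoneOn_of_hasDerivWithinAt_nonneg hs
    (f' := fun t => -(1 / 2) * c t 1 * ((c t 2) ^ 2 + γ * (c t 3) ^ 2))
    (fun t ht => (hasDerivWithinAt_components (h t ht).1).2.1.continuousWithinAt)
    (fun t ht => (hasDerivWithinAt_components (h t (interior_subset ht)).1).2.1.mono
      interior_subset) fun t ht => ?_
  have hx := (h t (interior_subset ht)).2.2
  exact mul_nonneg (by linarith) (by positivity)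

end Field

/-! ### Orbits with `x` bounded away from zero. -/

section AwayFromZero

variable {V : ℝ → ℝ} {γ : ℝ}

/-- The chart `(φ, y / x, z / x)` of the collapsing set: the coordinate `x`. -/
noncomputable def chartX (V : ℝ → ℝ) (q : Fin 3 → ℝ) : ℝ :=
  -√(3 / (V (q 0) + q 1 ^ 2 / 2 + q 2 ^ 2))

/-- The vector field in the chart `(φ, y / x, z / x)`. -/
noncomputable def chartField (V : ℝ → ℝ) (γ : ℝ) (q : Fin 3 → ℝ) : Fin 3 → ℝ :=
  ![-(chartX V q * q 1),
    deriv V (q 0) * chartX V q + 3 * q 1 - alpha γ * chartX V q * q 2 ^ 2,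
    1 / 2 * q 2 * (alpha γ * chartX V q * q 1 + 3 * γ)]

/-- The inverse of the chart `(φ, y / x, z / x)`. -/
noncomputable def chartInv (V : ℝ → ℝ) (q : Fin 3 → ℝ) : Phase :=
  !₂[q 0, chartX V q, chartX V q * q 1, chartX V q * q 2]

/-- The domain of the chart `(φ, y / x, z / x)`. -/
def chartDomain (V : ℝ → ℝ) : Set (Fin 3 → ℝ) :=
  {q | 0 < V (q 0) + q 1 ^ 2 / 2 + q 2 ^ 2}

theorem isOpen_chartDomain (hV : Continuous V) : IsOpen (chartDomain V) :=
  isOpen_lt continuous_const (by fun_prop)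

theorem contDiffOn_chartX (hV : ContDiff ℝ 2 V) : ContDiffOn ℝ 1 (chartX V) (chartDomain V) := by
  have hV1 : ContDiff ℝ 1 V := hV.of_le one_le_two
  have hG : ContDiff ℝ 1 fun q : Fin 3 → ℝ => V (q 0) + q 1 ^ 2 / 2 + q 2 ^ 2 := by fun_prop
  refine ContDiffOn.neg (ContDiffOn.sqrt (contDiffOn_const.div hG.contDiffOn ?_) ?_)
  · exact fun q hq => (ne_of_gt hq)
  · exact fun q hq => (div_pos three_pos hq).ne'

theorem contDiffOn_chartField (hV : ContDiff ℝ 2 V) :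
    ContDiffOn ℝ 1 (chartField V γ) (chartDomain V) := by
  have hX := contDiffOn_chartX hV
  have hV1 := contDiff_deriv_of_two hV
  have hd : ContDiffOn ℝ 1 (fun q : Fin 3 → ℝ => deriv V (q 0)) (chartDomain V) :=
    (hV1.comp (contDiff_apply ℝ ℝ 0)).contDiffOn
  have hq : ∀ i : Fin 3, ContDiffOn ℝ 1 (fun q : Fin 3 → ℝ => q i) (chartDomain V) := fun i =>
    (contDiff_apply ℝ ℝ i).contDiffOn
  have h0 := hq 0
  have h1 := hq 1
  have h2 := hq 2
  rw [contDiffOn_pi]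
  intro i
  fin_cases i <;> simp only [chartField] <;> simp <;> fun_prop

theorem contDiffOn_chartInv (hV : ContDiff ℝ 2 V) :
    ContDiffOn ℝ 1 (chartInv V) (chartDomain V) := by
  have hX := contDiffOn_chartX hV
  have hq : ∀ i : Fin 3, ContDiffOn ℝ 1 (fun q : Fin 3 → ℝ => q i) (chartDomain V) := fun i =>
    (contDiff_apply ℝ ℝ i).contDiffOn
  have h0 := hq 0
  have h1 := hq 1
  have h2 := hq 2
  rw [contDiffOn_euclidean]
  intro i
  fin_cases i <;> simp only [chartInv] <;> simp <;> fun_prop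

/-- The divergence from the derivatives along the coordinate lines. -/
theorem divergence_eq_of_hasDerivAt {X : (Fin 3 → ℝ) → Fin 3 → ℝ} {p : Fin 3 → ℝ}
    (hX : DifferentiableAt ℝ X p) {d : Fin 3 → ℝ}
    (hd : ∀ i, HasDerivAt (fun t => X (Function.update p i t) i) (d i) (p i)) :
    divergence X p = ∑ i, d i := by
  refine Finset.sum_congr rfl fun i _ => ?_
  have h1 : HasFDerivAt X (fderiv ℝ X p) (Function.update p i (p i)) := by
    rw [Function.update_eq_self]; exact hX.hasFDerivAt
  have h2 := hasDerivAt_pi.1 (h1.comp_hasDerivAt (p i) (hasDerivAt_update p i (p i))) i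
  exact h2.unique (hd i)

theorem hasDerivAt_neg_sqrt_three_div {g : ℝ → ℝ} {g' t : ℝ} (hg : HasDerivAt g g' t)
    (h0 : 0 < g t) :
    HasDerivAt (fun t => -√(3 / g t)) (√(3 / g t) / (2 * g t) * g') t := by
  have h1 := ((hasDerivAt_const t (3 : ℝ)).div hg h0.ne').sqrt (div_pos three_pos h0).ne'
  refine h1.neg.congr_deriv ?_
  have hs : √(3 / g t) * √(3 / g t) = 3 / g t := Real.mul_self_sqrt (div_pos three_pos h0).le
  have hs0 : √(3 / g t) ≠ 0 := (Real.sqrt_pos.2 (div_pos three_pos h0)).ne'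
  simp only [Pi.div_apply]
  rw [neg_eq_iff_eq_neg, div_eq_iff (by positivity)]
  have : -(√(3 / g t) / (2 * g t) * g') * (2 * √(3 / g t)) =
    -(√(3 / g t) * √(3 / g t)) / (2 * g t) * g' * 2 := by ring
  rw [this, hs]
  field_simp
  ring

/-- All terms containing derivatives of `chartX` cancel between the components. What remains depends
on the point only through `xY = -φ'`, and a weight linear in `φ` removes it. -/
theorem divergence_chartField (hV : ContDiff ℝ 2 V) {q : Fin 3 → ℝ} (hq : q ∈ chartDomain V) :
    divergence (chartField V γ) q = 3 + 3 / 2 * γ + 1 / 2 * alpha γ * (chartX V q * q 1) := by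
  have hdiff : DifferentiableAt ℝ (chartField V γ) q :=
    ((contDiffOn_chartField hV).contDiffAt
      ((isOpen_chartDomain hV.continuous).mem_nhds hq)).differentiableAt one_ne_zero
  have hVd : HasDerivAt V (deriv V (q 0)) (q 0) :=
    (hV.differentiable two_ne_zero (q 0)).hasDerivAt
  set G := V (q 0) + q 1 ^ 2 / 2 + q 2 ^ 2 with hG
  have hG0 : 0 < G := hq
  set S := √(3 / G) / (2 * G) with hS
  have hx0 : HasDerivAt (fun t => -√(3 / (V t + q 1 ^ 2 / 2 + q 2 ^ 2)))
      (S * deriv V (q 0)) (q 0) :=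
    hasDerivAt_neg_sqrt_three_div ((hVd.add_const _).add_const _) hG0
  have hx1 : HasDerivAt (fun t => -√(3 / (V (q 0) + t ^ 2 / 2 + q 2 ^ 2)))
      (S * q 1) (q 1) := by
    have h1 : HasDerivAt (fun t => V (q 0) + t ^ 2 / 2 + q 2 ^ 2) (q 1) (q 1) := by
      refine ((((hasDerivAt_id (q 1)).pow 2).div_const 2).const_add (V (q 0))).add_const
        (q 2 ^ 2) |>.congr_deriv ?_
      simp
    exact hasDerivAt_neg_sqrt_three_div h1 hG0
  have hx2 : HasDerivAt (fun t => -√(3 / (V (q 0) + q 1 ^ 2 / 2 + t ^ 2)))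
      (S * (2 * q 2)) (q 2) := by
    have h1 : HasDerivAt (fun t => V (q 0) + q 1 ^ 2 / 2 + t ^ 2) (2 * q 2) (q 2) := by
      refine ((hasDerivAt_id (q 2)).pow 2).const_add (V (q 0) + q 1 ^ 2 / 2) |>.congr_deriv ?_
      simp
    exact hasDerivAt_neg_sqrt_three_div h1 hG0
  rw [divergence_eq_of_hasDerivAt hdiff (d := ![-(S * deriv V (q 0) * q 1),
    deriv V (q 0) * (S * q 1) + 3 - alpha γ * (S * q 1) * q 2 ^ 2,
    1 / 2 * (alpha γ * chartX V q * q 1 + 3 * γ) +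
      1 / 2 * q 2 * (alpha γ * (S * (2 * q 2)) * q 1)])]
  · simp [Fin.sum_univ_three]
    ring
  · intro i
    fin_cases i
    · refine (((hx0.mul_const (q 1)).neg).congr_deriv ?_).congr_of_eventuallyEq
        (Eventually.of_forall fun t => ?_)
      · simp
      · simp [chartField, chartX]
    · refine ((((hx1.const_mul (deriv V (q 0))).add ((hasDerivAt_id (q 1)).const_mul 3)).sub
        ((hx1.const_mul (alpha γ)).mul_const (q 2 ^ 2))).congr_deriv ?_).congr_of_eventuallyEq
        (Eventually.of_forall fun t => ?_)
      · simp
      · simp [chartField, chartX]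
    · refine ((((hasDerivAt_id (q 2)).const_mul (1 / 2)).mul
        (((hx2.const_mul (alpha γ)).mul_const (q 1)).add_const (3 * γ))).congr_deriv
        ?_).congr_of_eventuallyEq (Eventually.of_forall fun t => ?_)
      · simp [chartX]
      · simp [chartField, chartX]

/-- The states from which `φ` remains bounded and `x` stays away from zero form a null set. -/
theorem hausdorffMeasure_x_away_from_zero (hV : ContDiff ℝ 2 V) (hγ : 0 ≤ γ) {N : ℝ} (hN : 0 < N) :
    Measure.hausdorffMeasure 3 {p : Phase | ∃ c : ℝ → Phase, c 0 = p ∧ IsCollapsingOrbit V γ c ∧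
      ∀ t, 0 ≤ t → |c t 0| ≤ N ∧ -N ≤ c t 1 ∧ c t 1 ≤ -(1 / N)} = 0 := by
  obtain ⟨M, hM⟩ := (isCompact_Icc (a := -N) (b := N)).exists_bound_of_continuousOn
    hV.continuous.continuousOn
  -- The constraint reads `V + Y²/2 + Z² = 3/x²`, so two-sided bounds on `x` are bounds on this
  -- expression.
  set K : Set (Fin 3 → ℝ) := {q | |q 0| ≤ N ∧ 3 / N ^ 2 ≤ V (q 0) + q 1 ^ 2 / 2 + q 2 ^ 2 ∧
    V (q 0) + q 1 ^ 2 / 2 + q 2 ^ 2 ≤ 3 * N ^ 2} with hKdef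
  have hVc := hV.continuous
  have hKclosed : IsClosed K := by
    have h0 : Continuous fun q : Fin 3 → ℝ => |q 0| := by fun_prop
    have h1 : Continuous fun q : Fin 3 → ℝ => V (q 0) + q 1 ^ 2 / 2 + q 2 ^ 2 := by fun_prop
    exact (isClosed_le h0 continuous_const).inter
      ((isClosed_le continuous_const h1).inter (isClosed_le h1 continuous_const))
  have hKcomp : IsCompact K := by
    refine Metric.isCompact_of_isClosed_isBounded hKclosed ?_
    refine (Metric.isBounded_closedBall (x := (0 : Fin 3 → ℝ))
      (r := N + 2 * (3 * N ^ 2 + M) + 1)).subset fun q hq => ?_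
    have h1 := abs_le.1 (hM (q 0) (abs_le.1 hq.1))
    have hM0 : 0 ≤ M := (norm_nonneg _).trans (hM (q 0) (abs_le.1 hq.1))
    have h2 := hq.2.2
    rw [mem_closedBall_zero_iff, pi_norm_le_iff_of_nonneg (by positivity)]
    intro i
    rw [Real.norm_eq_abs]
    fin_cases i
    · have := hq.1
      simp only [Fin.zero_eta]
      nlinarith
    · refine abs_le.2 ⟨?_, ?_⟩ <;> simp only [Fin.mk_one] <;> nlinarith [sq_nonneg (q 2)]
    · refine abs_le.2 ⟨?_, ?_⟩ <;> simp only [Fin.reduceFinMk] <;> nlinarith [sq_nonneg (q 1)]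
  have hKU : K ⊆ chartDomain V := fun q hq => lt_of_lt_of_le (by positivity) hq.2.1
  -- With the weight `αφ/2` the divergence is exactly `3 + 3γ/2 ≥ 3`.
  have hnull := volume_stay_eq_zero (isOpen_chartDomain hVc) (contDiffOn_chartField (γ := γ) hV)
    hKcomp hKU three_pos ((alpha γ / 2) • ContinuousLinearMap.proj (R := ℝ) 0) (fun q hq => by
      rw [divergence_chartField hV (hKU hq)]
      simp [chartField]
      nlinarith)
  refine measure_mono_null ?_ (hausdorffMeasure_image_eq_zero (isOpen_chartDomain hVc)
    (contDiffOn_chartInv hV) hKcomp hKU (A := {p | ∃ w : ℝ → Fin 3 → ℝ, w 0 = p ∧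
      ∀ t, 0 ≤ t → HasDerivWithinAt w (chartField V γ (w t)) (Ici 0) t ∧ w t ∈ K})
    (by rintro _ ⟨w, rfl, hw⟩; exact (hw 0 le_rfl).2) hnull)
  rintro _ ⟨c, rfl, hc, hbd⟩
  set w : ℝ → Fin 3 → ℝ := fun t => ![c t 0, c t 2 / c t 1, c t 3 / c t 1] with hw
  have hG : ∀ t, 0 ≤ t → V (w t 0) + w t 1 ^ 2 / 2 + w t 2 ^ 2 = 3 / c t 1 ^ 2 := by
    intro t ht
    obtain ⟨hcon, hx⟩ := (hc t ht).2
    have hx0 := hx.ne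
    simp [hw]
    field_simp
    linarith
  have hX : ∀ t, 0 ≤ t → chartX V (w t) = c t 1 := by
    intro t ht
    have hx := (hc t ht).2.2
    rw [chartX, hG t ht]
    have : 3 / (3 / c t 1 ^ 2) = (-c t 1) ^ 2 := by field_simp
    rw [this, Real.sqrt_sq (by linarith), neg_neg]
  refine ⟨w 0, ⟨w, rfl, fun t ht => ⟨?_, ?_, ?_, ?_⟩⟩, ?_⟩
  · obtain ⟨hφ, hx, hy, hz⟩ := hasDerivWithinAt_components (hc t ht).1
    have hx0 := (hc t ht).2.2.ne
    rw [hasDerivWithinAt_pi]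
    intro i
    fin_cases i
    · simp [chartField, hX t ht]
      refine hφ.congr_deriv ?_
      simp [hw]
      field_simp
    · simp [chartField, hX t ht]
      refine (hy.div hx hx0).congr_deriv ?_
      simp [hw]
      field_simp
      ring
    · simp [chartField, hX t ht]
      refine (hz.div hx hx0).congr_deriv ?_
      simp [hw]
      field_simp
      ring
  · simpa [hw] using (hbd t ht).1
  · rw [hG t ht]
    obtain ⟨-, h1, h2⟩ := hbd t ht
    have hN' : 0 < 1 / N := by positivity
    have hx := (hc t ht).2.2
    have hxp : 0 < c t 1 ^ 2 := by nlinarith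
    have : c t 1 ^ 2 ≤ N ^ 2 := by nlinarith
    gcongr
  · rw [hG t ht]
    obtain ⟨-, h1, h2⟩ := hbd t ht
    have hN' : 0 < 1 / N := by positivity
    have hx : (1 / N) ^ 2 ≤ c t 1 ^ 2 := by nlinarith
    calc 3 / c t 1 ^ 2 ≤ 3 / (1 / N) ^ 2 := by gcongr
      _ = 3 * N ^ 2 := by field_simp
  · have hx0 := (hc 0 le_rfl).2.2.ne
    ext i
    fin_cases i <;> simp [chartInv, hX 0 le_rfl] <;> simp [hw] <;> field_simp

end AwayFromZero

/-! ### The case `γ = 4/3` near `x = y = 0`. -/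

section Radiation

variable {V : ℝ → ℝ}

theorem alpha_four_thirds : alpha (4 / 3) = 0 := by norm_num [alpha]

/-- The square of `z` on the constraint set, in the coordinates `(φ, s, y)` with `x = -s⁴`. -/
noncomputable def radiationDensity (V : ℝ → ℝ) (q : Fin 3 → ℝ) : ℝ :=
  3 - q 2 ^ 2 / 2 - V (q 0) * q 1 ^ 8

/-- The vector field for `γ = 4 / 3` in the coordinates `(φ, s, y)` with `x = -s⁴`. -/
noncomputable def radiationField (V : ℝ → ℝ) (q : Fin 3 → ℝ) : Fin 3 → ℝ :=
  ![-q 2,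
    -(1 / 8) * q 1 * (q 2 ^ 2 + 4 / 3 * radiationDensity V q),
    deriv V (q 0) * q 1 ^ 8 + 3 * q 2 - 1 / 2 * q 2 ^ 3 - 2 / 3 * radiationDensity V q * q 2]

/-- The collapsing state with given coordinates `(φ, s, y)`, where `x = -s⁴`, and given sign of
`z`. -/
noncomputable def radiationState (V : ℝ → ℝ) (ε : ℝ) (q : Fin 3 → ℝ) : Phase :=
  !₂[q 0, -q 1 ^ 4, q 2, ε * √(radiationDensity V q)]

theorem contDiff_radiationDensity (hV : ContDiff ℝ 2 V) : ContDiff ℝ 1 (radiationDensity V) := by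
  have hV1 : ContDiff ℝ 1 V := hV.of_le one_le_two
  unfold radiationDensity
  fun_prop

theorem contDiff_radiationField (hV : ContDiff ℝ 2 V) : ContDiff ℝ 1 (radiationField V) := by
  have hρ := contDiff_radiationDensity hV
  have hd : ContDiff ℝ 1 (fun q : Fin 3 → ℝ => deriv V (q 0)) :=
    (contDiff_deriv_of_two hV).comp (contDiff_apply ℝ ℝ 0)
  rw [contDiff_pi]
  intro i
  fin_cases i <;> simp only [radiationField] <;> simp <;> fun_prop

theorem contDiffOn_radiationState (hV : ContDiff ℝ 2 V) (ε : ℝ) :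
    ContDiffOn ℝ 1 (radiationState V ε) {q | 0 < radiationDensity V q} := by
  have hρ : ContDiffOn ℝ 1 (fun q => √(radiationDensity V q)) {q | 0 < radiationDensity V q} :=
    (contDiff_radiationDensity hV).contDiffOn.sqrt fun q hq => ne_of_gt hq
  have hq : ∀ i : Fin 3, ContDiffOn ℝ 1 (fun q : Fin 3 → ℝ => q i)
      {q | 0 < radiationDensity V q} := fun i => (contDiff_apply ℝ ℝ i).contDiffOn
  have h0 := hq 0
  have h1 := hq 1
  have h2 := hq 2
  rw [contDiffOn_euclidean]
  intro i
  fin_cases i <;> simp only [radiationState] <;> simp <;> fun_prop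

/-- The value `1/2` at `s = y = 0` is the expansion `1` in `y` minus the contraction `1/2` in `s`.
In the coordinate `x` the contraction rate is `2` and the sum would be negative. -/
theorem divergence_radiationField (hV : ContDiff ℝ 2 V) (q : Fin 3 → ℝ) :
    divergence (radiationField V) q =
      1 / 2 - 13 / 24 * q 2 ^ 2 + 13 / 6 * (V (q 0) * q 1 ^ 8) := by
  have hs : HasDerivAt (fun t => radiationDensity V (Function.update q 1 t))
      (-(V (q 0) * (8 * q 1 ^ 7))) (q 1) := by
    have h := (((hasDerivAt_id (q 1)).pow 8).const_mul (V (q 0))).const_sub (3 - q 2 ^ 2 / 2)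
    refine (h.congr_deriv ?_).congr_of_eventuallyEq (Eventually.of_forall fun t => ?_)
    · simp
    · simp [radiationDensity]
  have hy : HasDerivAt (fun t => radiationDensity V (Function.update q 2 t)) (-q 2) (q 2) := by
    have h := ((((hasDerivAt_id (q 2)).pow 2).div_const 2).const_sub 3).sub_const
      (V (q 0) * q 1 ^ 8)
    refine (h.congr_deriv ?_).congr_of_eventuallyEq (Eventually.of_forall fun t => ?_)
    · simp
    · simp [radiationDensity]
  rw [divergence_eq_of_hasDerivAt
    ((contDiff_radiationField hV).differentiable one_ne_zero q) (d := ![0,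
    -(1 / 8) * (q 2 ^ 2 + 4 / 3 * radiationDensity V q) +
      -(1 / 8) * q 1 * (4 / 3 * -(V (q 0) * (8 * q 1 ^ 7))),
    3 - 3 / 2 * q 2 ^ 2 - (2 / 3 * -q 2 * q 2 + 2 / 3 * radiationDensity V q)])]
  · simp [Fin.sum_univ_three, radiationDensity]
    ring
  · intro i
    fin_cases i
    · refine (hasDerivAt_const (q 0) (-q 2)).congr_of_eventuallyEq
        (Eventually.of_forall fun t => ?_)
      simp [radiationField]
    · have h := ((hasDerivAt_id (q 1)).const_mul (-(1 / 8))).mul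
        ((hs.const_mul (4 / 3)).const_add (q 2 ^ 2))
      refine (h.congr_deriv ?_).congr_of_eventuallyEq (Eventually.of_forall fun t => ?_)
      · simp
      · simp [radiationField]
    · have h := ((((hasDerivAt_id (q 2)).const_mul 3).const_add (deriv V (q 0) * q 1 ^ 8)).sub
        (((hasDerivAt_id (q 2)).pow 3).const_mul (1 / 2))).sub
        ((hy.const_mul (2 / 3)).mul (hasDerivAt_id (q 2)))
      refine (h.congr_deriv ?_).congr_of_eventuallyEq (Eventually.of_forall fun t => ?_)
      · simp
        ring
      · simp [radiationField]

/-- For `γ = 4 / 3`, the states from which `φ` remains bounded while `x` and `y` remain small form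
a null set. -/
theorem hausdorffMeasure_radiation (hV : ContDiff ℝ 2 V) {N M e : ℝ}
    (hM : ∀ φ, |φ| ≤ N → |V φ| ≤ M) (he : 0 ≤ e) (heM : M * e ^ 8 ≤ 1 / 24) :
    Measure.hausdorffMeasure 3 {p : Phase | ∃ c : ℝ → Phase, c 0 = p ∧
      IsCollapsingOrbit V (4 / 3) c ∧
      ∀ t, 0 ≤ t → |c t 0| ≤ N ∧ -e ^ 4 ≤ c t 1 ∧ |c t 2| ≤ 1 / 2} = 0 := by
  set K : Set (Fin 3 → ℝ) := Icc ![-N, 0, -(1 / 2)] ![N, e, 1 / 2] with hKdef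
  have hmem : ∀ q, q ∈ K ↔ |q 0| ≤ N ∧ (0 ≤ q 1 ∧ q 1 ≤ e) ∧ |q 2| ≤ 1 / 2 := fun q => by
    simp only [hKdef, mem_Icc, Pi.le_def, Fin.forall_fin_succ, abs_le]
    simp
    tauto
  have hKcomp : IsCompact K := isCompact_Icc
  have hsmall : ∀ q ∈ K, |V (q 0) * q 1 ^ 8| ≤ 1 / 24 := fun q hq => by
    obtain ⟨h0, ⟨h1, h1'⟩, -⟩ := (hmem q).1 hq
    rw [abs_mul, abs_of_nonneg (by positivity : 0 ≤ q 1 ^ 8)]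
    calc |V (q 0)| * q 1 ^ 8 ≤ M * e ^ 8 := by
          have := hM _ h0
          have hM0 : 0 ≤ M := (abs_nonneg _).trans this
          gcongr
      _ ≤ 1 / 24 := heM
  have hy2 : ∀ q ∈ K, q 2 ^ 2 ≤ 1 / 4 := fun q hq => by
    have := abs_le.1 ((hmem q).1 hq).2.2
    nlinarith
  have hU : IsOpen {q | 0 < radiationDensity V q} :=
    isOpen_lt continuous_const (contDiff_radiationDensity hV).continuous
  -- On `K` the density `z²` is at least `3 - 1/8 - 1/24`, so `z` is a smooth function of the
  -- coordinates up to its sign.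
  have hKU : K ⊆ {q | 0 < radiationDensity V q} := fun q hq => by
    have h1 := abs_le.1 (hsmall q hq)
    have h2 := hy2 q hq
    simp only [mem_ofPred_eq, radiationDensity]
    linarith
  -- No weight is needed: `1/2 - 13/96 - 13/144 > 1/4`.
  have hnull := volume_stay_eq_zero isOpen_univ (contDiff_radiationField hV).contDiffOn
    hKcomp (subset_univ _) (show (0 : ℝ) < 1 / 4 by norm_num) 0 (fun q hq => by
      rw [divergence_radiationField hV]
      have h1 := abs_le.1 (hsmall q hq)
      have h2 := hy2 q hq
      simp
      linarith)
  have himage : ∀ ε : ℝ, Measure.hausdorffMeasure 3 (radiationState V ε '' {p |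
      ∃ w : ℝ → Fin 3 → ℝ, w 0 = p ∧
        ∀ t, 0 ≤ t → HasDerivWithinAt w (radiationField V (w t)) (Ici 0) t ∧ w t ∈ K}) = 0 :=
    fun ε => hausdorffMeasure_image_eq_zero hU (contDiffOn_radiationState hV ε) hKcomp hKU
      (by rintro _ ⟨w, rfl, hw⟩; exact (hw 0 le_rfl).2) hnull
  refine measure_mono_null ?_ (measure_union_null (himage 1) (himage (-1)))
  rintro _ ⟨c, rfl, hc, hbd⟩
  set w : ℝ → Fin 3 → ℝ := fun t => ![c t 0, √(√(-c t 1)), c t 2] with hw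
  have hs2 : ∀ t, 0 ≤ t → √(-c t 1) ^ 2 = -c t 1 := fun t ht =>
    Real.sq_sqrt (by linarith [(hc t ht).2.2])
  have hs1 : ∀ t, √(√(-c t 1)) ^ 2 = √(-c t 1) := fun t =>
    Real.sq_sqrt (Real.sqrt_nonneg _)
  have hs4 : ∀ t, 0 ≤ t → √(√(-c t 1)) ^ 4 = -c t 1 := fun t ht => by
    calc √(√(-c t 1)) ^ 4 = (√(√(-c t 1)) ^ 2) ^ 2 := by ring
      _ = -c t 1 := by rw [hs1, hs2 t ht]
  have hs8 : ∀ t, 0 ≤ t → √(√(-c t 1)) ^ 8 = c t 1 ^ 2 := fun t ht => by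
    have : √(√(-c t 1)) ^ 8 = (√(√(-c t 1)) ^ 4) ^ 2 := by ring
    rw [this, hs4 t ht, neg_sq]
  have hρ : ∀ t, 0 ≤ t → radiationDensity V (w t) = c t 3 ^ 2 := fun t ht => by
    have h1 := (hc t ht).2.1
    simp [radiationDensity, hw, hs8 t ht]
    linarith
  have hwA : w 0 ∈ {p | ∃ w : ℝ → Fin 3 → ℝ, w 0 = p ∧
        ∀ t, 0 ≤ t → HasDerivWithinAt w (radiationField V (w t)) (Ici 0) t ∧ w t ∈ K} := by
    refine ⟨w, rfl, fun t ht => ⟨?_, ?_⟩⟩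
    · obtain ⟨hφ, hx, hy, hz⟩ := hasDerivWithinAt_components (hc t ht).1
      have hxneg := (hc t ht).2.2
      have hu : 0 < √(-c t 1) := Real.sqrt_pos.2 (by linarith)
      have hs : 0 < √(√(-c t 1)) := Real.sqrt_pos.2 hu
      rw [hasDerivWithinAt_pi]
      intro i
      fin_cases i
      · simpa [radiationField, hw] using hφ
      · have h1 := (hx.neg.sqrt (by simp only [Pi.neg_apply]; linarith)).sqrt
          (by simp only [Pi.neg_apply]; exact hu.ne')
        simp [radiationField, hρ t ht]
        refine h1.congr_deriv ?_
        simp only [Pi.neg_apply]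
        simp [hw]
        rw [div_div, div_eq_iff (by positivity)]
        have e1 : √(√(-c t 1)) * (2 * √(-c t 1) * (2 * √(√(-c t 1)))) = -4 * c t 1 := by
          calc _ = 4 * √(-c t 1) * √(√(-c t 1)) ^ 2 := by ring
            _ = 4 * √(-c t 1) ^ 2 := by rw [hs1]; ring
            _ = _ := by rw [hs2 t ht]; ring
        linear_combination (1 / 8 : ℝ) * (c t 2 ^ 2 + 4 / 3 * c t 3 ^ 2) * e1
      · simp [radiationField, hρ t ht]
        refine hy.congr_deriv ?_
        simp [hw, hs8 t ht, alpha_four_thirds]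
        ring
    · obtain ⟨h0, h1, h2⟩ := hbd t ht
      refine (hmem _).2 ⟨by simpa [hw] using h0, ⟨?_, ?_⟩, by simpa [hw] using h2⟩
      · simp [hw]
      · have h4 : √(√(-c t 1)) ^ 4 ≤ e ^ 4 := by rw [hs4 t ht]; linarith
        have := le_of_pow_le_pow_left₀ four_ne_zero he h4
        simpa [hw] using this
  -- The coordinates forget the sign of `z`; each sign has its own parametrization.
  rcases le_total 0 (c 0 3) with hz | hz
  · refine Or.inl ⟨w 0, hwA, ?_⟩
    ext i
    fin_cases i <;> simp [radiationState, hρ 0 le_rfl, Real.sqrt_sq hz] <;>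
      simp [hw, hs4 0 le_rfl]
  · refine Or.inr ⟨w 0, hwA, ?_⟩
    ext i
    fin_cases i <;> simp [radiationState, hρ 0 le_rfl, Real.sqrt_sq_eq_abs, abs_of_nonpos hz] <;>
      simp [hw, hs4 0 le_rfl]

end Radiation

/-! ### Consequences of bounded `φ` when `x` becomes small, and compactness. -/

section Dynamics

variable {V : ℝ → ℝ} {γ : ℝ}

theorem exists_potential_bound (hV : ContDiff ℝ 2 V) (N : ℝ) :
    ∃ M, ∀ φ, |φ| ≤ N → |V φ| ≤ M ∧ |deriv V φ| ≤ M := by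
  obtain ⟨M₁, h₁⟩ := (isCompact_Icc (a := -N) (b := N)).exists_bound_of_continuousOn
    hV.continuous.continuousOn
  obtain ⟨M₂, h₂⟩ := (isCompact_Icc (a := -N) (b := N)).exists_bound_of_continuousOn
    (contDiff_deriv_of_two hV).continuous.continuousOn
  exact ⟨max M₁ M₂, fun φ hφ => ⟨(h₁ φ (abs_le.1 hφ)).trans (le_max_left _ _),
    (h₂ φ (abs_le.1 hφ)).trans (le_max_right _ _)⟩⟩

/-- On the constraint set, `z` can be eliminated from the equation for `y`. -/
theorem IsCollapsingOrbit.hasDerivWithinAt_y {c : ℝ → Phase} (h : IsCollapsingOrbit V γ c) {t : ℝ}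
    (ht : 0 ≤ t) : HasDerivWithinAt (fun t => c t 2)
      ((3 - c t 2 ^ 2 / 2) * ((1 - γ / 2) * c t 2 - alpha γ) +
        (c t 1 ^ 2 * deriv V (c t 0) + c t 1 ^ 2 * V (c t 0) * (alpha γ + γ / 2 * c t 2)))
      (Ici 0) t := by
  refine (hasDerivWithinAt_components (h t ht).1).2.2.1.congr_deriv ?_
  have hcon := (h t ht).2.1
  linear_combination (-(alpha γ + γ / 2 * c t 2)) * hcon

theorem abs_alpha_le (hγ₀ : 0 ≤ γ) (hγ₂ : γ ≤ 2) : |alpha γ| ≤ 2 := by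
  have h6 : (2 : ℝ) ≤ √6 := Real.le_sqrt_of_sq_le (by norm_num)
  rw [alpha, abs_div, abs_of_pos (by linarith : 0 < √6), div_le_iff₀ (by linarith)]
  rw [abs_le]
  constructor <;> linarith

/-- Outside the case of radiation, `φ` is unbounded as soon as `x` tends to zero. -/
theorem IsCollapsingOrbit.false_of_alpha_ne_zero {c : ℝ → Phase} (h : IsCollapsingOrbit V γ c)
    (hγ₀ : 0 ≤ γ) (hγ₂ : γ ≤ 2) (hα : alpha γ ≠ 0) {N M a : ℝ} (ha : 0 ≤ a)
    (hM : ∀ φ, |φ| ≤ N → |V φ| ≤ M ∧ |deriv V φ| ≤ M)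
    (hN : ∀ t, 0 ≤ t → |c t 0| ≤ N) (hx : ∀ t, a ≤ t → c t 1 ^ 2 * M ≤ |alpha γ| / 16) :
    False := by
  have hαpos : 0 < |alpha γ| := abs_pos.2 hα
  have hα2 := abs_alpha_le hγ₀ hγ₂
  have hIci : Ici a ⊆ Ici (0 : ℝ) := Ici_subset_Ici.2 ha
  have hφ : ∀ t, a ≤ t → HasDerivWithinAt (fun t => c t 0) (-(c t 2)) (Ici a) t := fun t ht =>
    (hasDerivWithinAt_components (h t (ha.trans ht)).1).1.mono hIci
  have hy := fun t (ht : a ≤ t) => (h.hasDerivWithinAt_y (ha.trans ht)).mono hIci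
  -- The perturbation is at most `|α|/16 + 3|α|/16`. The main term has size at least `(5/2)(|α|/2)`
  -- because `|y| ≤ |α|/2 ≤ 1`, so the net rate is at least `|α|`.
  have hrest : ∀ t, a ≤ t → |c t 2| ≤ |alpha γ| / 2 →
      |c t 1 ^ 2 * deriv V (c t 0) + c t 1 ^ 2 * V (c t 0) * (alpha γ + γ / 2 * c t 2)|
        ≤ |alpha γ| / 4 := by
    intro t ht hyt
    obtain ⟨h1, h2⟩ := hM _ (hN t (ha.trans ht))
    have hx2 : 0 ≤ c t 1 ^ 2 := sq_nonneg _
    have h3 : |c t 1 ^ 2 * deriv V (c t 0)| ≤ |alpha γ| / 16 := by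
      rw [abs_mul, abs_of_nonneg hx2]
      exact (mul_le_mul_of_nonneg_left h2 hx2).trans (hx t ht)
    have h4 : |c t 1 ^ 2 * V (c t 0)| ≤ |alpha γ| / 16 := by
      rw [abs_mul, abs_of_nonneg hx2]
      exact (mul_le_mul_of_nonneg_left h1 hx2).trans (hx t ht)
    have h5 : |alpha γ + γ / 2 * c t 2| ≤ 3 := by
      refine (abs_add_le _ _).trans ?_
      rw [abs_mul, abs_of_nonneg (by linarith : 0 ≤ γ / 2)]
      nlinarith [abs_nonneg (c t 2)]
    refine (abs_add_le _ _).trans ?_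
    rw [abs_mul (c t 1 ^ 2 * V (c t 0))]
    nlinarith [abs_nonneg (c t 1 ^ 2 * V (c t 0)), abs_nonneg (alpha γ + γ / 2 * c t 2)]
  rcases lt_or_gt_of_ne hα with hneg | hpos
  · rw [abs_of_neg hneg] at *
    refine unbounded_primitive_of_decreasing (f := fun t => c t 0) (w := fun t => -(c t 2))
      (δ := -alpha γ / 2) (η := -alpha γ) (a := a) (N := N) (by linarith) (by linarith) hφ
      (fun t ht => (hy t ht).neg) (fun t ht hyt => ?_) (fun t ht => hN t (ha.trans ht))
    rw [abs_neg] at hyt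
    have h1 := abs_le.1 (hrest t ht hyt)
    have h2 := abs_le.1 hyt
    have h3 : c t 2 ^ 2 ≤ 1 := by nlinarith
    have h4 : -alpha γ / 2 ≤ (1 - γ / 2) * c t 2 - alpha γ := by nlinarith
    nlinarith
  · rw [abs_of_pos hpos] at *
    refine unbounded_primitive_of_decreasing (f := fun t => -(c t 0)) (w := fun t => c t 2)
      (δ := alpha γ / 2) (η := alpha γ) (a := a) (N := N) (by linarith) (by linarith)
      (fun t ht => (hφ t ht).neg.congr_deriv (neg_neg _))
      hy (fun t ht hyt => ?_) (fun t ht => by rw [abs_neg]; exact hN t (ha.trans ht))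
    have h1 := abs_le.1 (hrest t ht hyt)
    have h2 := abs_le.1 hyt
    have h3 : c t 2 ^ 2 ≤ 1 := by nlinarith
    have h4 : (1 - γ / 2) * c t 2 - alpha γ ≤ -(alpha γ / 2) := by nlinarith
    nlinarith

/-- In the case of radiation, `y` becomes small if `φ` is bounded and `x` tends to zero. -/
theorem IsCollapsingOrbit.abs_y_le_of_radiation {c : ℝ → Phase}
    (h : IsCollapsingOrbit V (4 / 3) c) {N M a : ℝ} (ha : 0 ≤ a)
    (hM : ∀ φ, |φ| ≤ N → |V φ| ≤ M ∧ |deriv V φ| ≤ M)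
    (hN : ∀ t, 0 ≤ t → |c t 0| ≤ N) (hx : ∀ t, a ≤ t → c t 1 ^ 2 * M ≤ 1 / 24) :
    ∀ t, a ≤ t → |c t 2| ≤ 1 / 2 := by
  have hIci : Ici a ⊆ Ici (0 : ℝ) := Ici_subset_Ici.2 ha
  have hφ : ∀ t, a ≤ t → HasDerivWithinAt (fun t => c t 0) (-(c t 2)) (Ici a) t := fun t ht =>
    (hasDerivWithinAt_components (h t (ha.trans ht)).1).1.mono hIci
  have hy := fun t (ht : a ≤ t) => (h.hasDerivWithinAt_y (ha.trans ht)).mono hIci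
  have hrest : ∀ t, a ≤ t → |c t 1 ^ 2 * deriv V (c t 0)| ≤ 1 / 24 ∧
      |c t 1 ^ 2 * V (c t 0)| ≤ 1 / 24 := by
    intro t ht
    obtain ⟨h1, h2⟩ := hM _ (hN t (ha.trans ht))
    have hx2 : 0 ≤ c t 1 ^ 2 := sq_nonneg _
    rw [abs_mul, abs_mul, abs_of_nonneg hx2]
    exact ⟨(mul_le_mul_of_nonneg_left h2 hx2).trans (hx t ht),
      (mul_le_mul_of_nonneg_left h1 hx2).trans (hx t ht)⟩
  -- At `y = 1/2` the main term `(3 - y²/2)y/3` is `23/48`, which outweighs the perturbation; the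
  -- level `-1/2` is symmetric.
  have hup := lt_of_bounded_primitive (f := fun t => -(c t 0)) (w := fun t => c t 2)
    (δ := 1 / 2) (a := a) (N := N) (by norm_num) (fun t ht => (hφ t ht).neg.congr_deriv (neg_neg _)) hy
    (fun t ht hyt => by
      obtain ⟨h1, h2⟩ := hrest t ht
      rw [abs_le] at h1 h2
      rw [hyt, alpha_four_thirds]
      linarith [h1.1, h2.1]) (fun t ht => by rw [abs_neg]; exact hN t (ha.trans ht))
  have hdown := lt_of_bounded_primitive (f := fun t => c t 0) (w := fun t => -(c t 2))
    (δ := 1 / 2) (a := a) (N := N) (by norm_num) hφ (fun t ht => (hy t ht).neg)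
    (fun t ht hyt => by
      obtain ⟨h1, h2⟩ := hrest t ht
      rw [abs_le] at h1 h2
      have hyt' : c t 2 = -(1 / 2) := by linarith
      rw [hyt', alpha_four_thirds]
      linarith [h1.2, h2.1, h2.2]) (fun t ht => hN t (ha.trans ht))
  exact fun t ht => abs_le.2 ⟨by linarith [hdown t ht], (hup t ht).le⟩

theorem ordConnected_forwardInterval (T : EReal) : OrdConnected (forwardInterval T) :=
  ⟨fun _ hs _ ht _ hu => ⟨hs.1.trans hu.1, (EReal.coe_le_coe_iff.2 hu.2).trans_lt ht.2⟩⟩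

/-- A continuous function with finite upper limit of its modulus at the end of the interval of
definition is bounded. -/
theorem exists_bound_of_limsup_ne_top {f : ℝ → ℝ} {T : EReal} (hT : 0 < T)
    (hf : ContinuousOn f (forwardInterval T))
    (h : limsup (fun τ : ℝ => ((|f τ| : ℝ) : EReal)) (towardsEnd T) ≠ ⊤) :
    ∃ N : ℝ, ∀ t ∈ forwardInterval T, |f t| ≤ N := by
  obtain ⟨a, ha, -⟩ := EReal.lt_iff_exists_real_btwn.1 (lt_top_iff_ne_top.2 h)
  have hev := eventually_lt_of_limsup_lt ha
  obtain ⟨s, hs, hsub⟩ := mem_comap.1 hev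
  obtain ⟨l, hl, hls⟩ := (mem_nhdsLT_iff_exists_Ioo_subset' hT).1 hs
  obtain ⟨r, hr, hrT⟩ := EReal.lt_iff_exists_real_btwn.1 (max_lt hl hT)
  have hr0 : 0 ≤ r := by
    have := (le_max_right l 0).trans hr.le
    exact_mod_cast this
  have hrmem : r ∈ forwardInterval T := ⟨hr0, hrT⟩
  obtain ⟨b, hb⟩ := (isCompact_Icc (a := 0) (b := r)).exists_bound_of_continuousOn
    (hf.mono (Icc_subset_forwardInterval hrmem))
  refine ⟨max a b, fun t ht => ?_⟩
  rcases le_total t r with htr | htr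
  · exact (hb t ⟨ht.1, htr⟩).trans (le_max_right _ _)
  · have h1 : ((|f t| : ℝ) : EReal) < a := by
      refine hsub (hls ⟨?_, ht.2⟩)
      exact ((le_max_left l 0).trans_lt hr).trans_le (EReal.coe_le_coe_iff.2 htr)
    have h2 : |f t| < a := by exact_mod_cast h1
    exact h2.le.trans (le_max_left _ _)

/-- Collapsing states with bounded `φ` and `x` are bounded. -/
theorem norm_le_of_mem_collapsing {p : Phase} (hp : p ∈ collapsing V) {N M R : ℝ}
    (hN : |p 0| ≤ N) (hM : |V (p 0)| ≤ M) (hR : |p 1| ≤ R) :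
    ‖p‖ ≤ √(N ^ 2 + R ^ 2 + 2 * (3 + M * R ^ 2) + (3 + M * R ^ 2)) := by
  rw [EuclideanSpace.norm_eq]
  apply Real.sqrt_le_sqrt
  simp only [Fin.sum_univ_four, Real.norm_eq_abs, sq_abs]
  have hcon := hp.1
  have h0 : p 0 ^ 2 ≤ N ^ 2 := sq_le_sq.2 (hN.trans (le_abs_self _))
  have h1 : p 1 ^ 2 ≤ R ^ 2 := sq_le_sq.2 (hR.trans (le_abs_self _))
  have hM0 : 0 ≤ M := (abs_nonneg _).trans hM
  have h2 : -(M * R ^ 2) ≤ V (p 0) * p 1 ^ 2 := by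
    have h3 : |V (p 0) * p 1 ^ 2| ≤ M * R ^ 2 := by
      rw [abs_mul, abs_of_nonneg (sq_nonneg (p 1))]
      gcongr
    exact (abs_le.1 h3).1
  have := sq_nonneg (p 2)
  have := sq_nonneg (p 3)
  linarith

end Dynamics

/-! ### The exceptional states form a countable union of null sets. -/

section Null

variable {V : ℝ → ℝ} {γ : ℝ}

theorem eq_four_thirds_of_alpha_eq_zero (h : alpha γ = 0) : γ = 4 / 3 := by
  have h6 : √6 ≠ 0 := by positivity
  rw [alpha, div_eq_zero_iff] at h
  rcases h with h | h
  · linarith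
  · exact absurd h h6

theorem exists_small_radius (M : ℝ) : ∃ e : ℝ, 0 < e ∧ M * e ^ 8 ≤ 1 / 24 := by
  refine ⟨min 1 (1 / (24 * (|M| + 1))), lt_min one_pos (by positivity), ?_⟩
  set e := min 1 (1 / (24 * (|M| + 1))) with he
  have he0 : 0 < e := lt_min one_pos (by positivity)
  have he1 : e ≤ 1 := min_le_left _ _
  have he2 : e ≤ 1 / (24 * (|M| + 1)) := min_le_right _ _
  have h8 : e ^ 8 ≤ e := by
    calc e ^ 8 ≤ e ^ 1 := pow_le_pow_of_le_one he0.le he1 (by norm_num)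
      _ = e := pow_one e
  rw [le_div_iff₀ (by positivity)] at he2
  have h1 : M * e ^ 8 ≤ |M| * e := by
    have := le_abs_self M
    have := abs_nonneg M
    nlinarith [pow_pos he0 8]
  nlinarith

/-- Almost no state has a global collapsing orbit on which `φ` and `x` remain bounded. -/
theorem hausdorffMeasure_bounded_orbit_eq_zero (hV : ContDiff ℝ 2 V) (hγ₀ : 0 ≤ γ) (hγ₂ : γ ≤ 2) :
    Measure.hausdorffMeasure 3 {p : Phase | ∃ c : ℝ → Phase, c 0 = p ∧ IsCollapsingOrbit V γ c ∧
      ∃ N R : ℝ, ∀ t, 0 ≤ t → |c t 0| ≤ N ∧ |c t 1| ≤ R} = 0 := by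
  choose M hM using fun N : ℕ => exists_potential_bound hV (N : ℝ)
  choose e he heM using fun N : ℕ => exists_small_radius (M N)
  set B : ℕ → Set Phase := fun N => {p : Phase | ∃ c : ℝ → Phase, c 0 = p ∧
    IsCollapsingOrbit V γ c ∧ ∀ t, 0 ≤ t → |c t 0| ≤ (N + 1 : ℝ) ∧ -(N + 1 : ℝ) ≤ c t 1 ∧
      c t 1 ≤ -(1 / (N + 1 : ℝ))} with hB
  set A : ℕ → Set Phase := fun N => {p : Phase | ∃ c : ℝ → Phase, c 0 = p ∧
    IsCollapsingOrbit V (4 / 3) c ∧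
      ∀ t, 0 ≤ t → |c t 0| ≤ N ∧ -e N ^ 4 ≤ c t 1 ∧ |c t 2| ≤ 1 / 2} with hA
  -- Smallness of `x` and `y` begins only at some time, here the integer `n`; until then the orbit
  -- stays in a ball, where the flow pulls null sets back to null sets.
  set D : ℕ → ℕ → ℕ → Set Phase := fun N k n => {p : Phase | ∃ c : ℝ → Phase, c 0 = p ∧
    (∀ t ∈ Icc (0 : ℝ) n, HasDerivWithinAt c (field V γ (c t)) (Icc (0 : ℝ) n) t ∧
      c t ∈ Metric.closedBall (0 : Phase) k) ∧ c n ∈ A N} with hD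
  have hBnull : ∀ N, Measure.hausdorffMeasure 3 (B N) = 0 := fun N =>
    hausdorffMeasure_x_away_from_zero hV hγ₀ (N := (N + 1 : ℝ)) (by positivity)
  have hAnull : ∀ N, Measure.hausdorffMeasure 3 (A N) = 0 := fun N =>
    hausdorffMeasure_radiation hV (fun φ hφ => (hM N φ hφ).1) (he N).le (heM N)
  have hDnull : ∀ N k n, Measure.hausdorffMeasure 3 (D N k n) = 0 := fun N k n =>
    hausdorffMeasure_preimage_eq_zero (contDiff_field hV) (isCompact_closedBall _ _)
      (by norm_num) (hAnull N) n.cast_nonneg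
  refine measure_mono_null (t := (⋃ N, B N) ∪ ⋃ N, ⋃ k, ⋃ n, D N k n) ?_
    (measure_union_null (measure_iUnion_null hBnull) (measure_iUnion_null fun N =>
      measure_iUnion_null fun k => measure_iUnion_null fun n => hDnull N k n))
  rintro _ ⟨c, rfl, hc, N, R, hbd⟩
  have hmono : MonotoneOn (fun t => c t 1) (Ici 0) := monotoneOn_x (convex_Ici 0) hγ₀ hc
  by_cases hfin : ∃ k : ℕ, ∀ t, 0 ≤ t → c t 1 ≤ -(1 / (k + 1 : ℝ))
  · obtain ⟨k, hk⟩ := hfin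
    obtain ⟨m, hm⟩ := exists_nat_ge (max (max N R) k)
    have hmN : N ≤ m := ((le_max_left _ _).trans (le_max_left _ _)).trans hm
    have hmR : R ≤ m := ((le_max_right _ _).trans (le_max_left _ _)).trans hm
    have hmk : (k : ℝ) ≤ m := (le_max_right _ _).trans hm
    refine Or.inl (mem_iUnion.2 ⟨m, c, rfl, hc, fun t ht => ⟨?_, ?_, ?_⟩⟩)
    · linarith [(hbd t ht).1]
    · linarith [(abs_le.1 (hbd t ht).2).1]
    · refine (hk t ht).trans (neg_le_neg ?_)
      gcongr
  · push Not at hfin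
    have hsmall : ∀ ε > 0, ∃ n : ℕ, ∀ t, (n : ℝ) ≤ t → -ε ≤ c t 1 := by
      intro ε hε
      obtain ⟨k, hk⟩ := exists_nat_one_div_lt hε
      obtain ⟨t₀, ht₀, hx₀⟩ := hfin k
      obtain ⟨n, hn⟩ := exists_nat_ge t₀
      refine ⟨n, fun t ht => ?_⟩
      have := hmono (mem_Ici.2 ht₀) (mem_Ici.2 (ht₀.trans (hn.trans ht))) (hn.trans ht)
      simp only at this
      linarith
    obtain ⟨m, hm⟩ := exists_nat_ge N
    have hbm : ∀ t, 0 ≤ t → |c t 0| ≤ m := fun t ht => (hbd t ht).1.trans hm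
    have hMnn : 0 ≤ M m :=
      (abs_nonneg _).trans (hM m 0 (by rw [abs_zero]; exact m.cast_nonneg)).1
    have hsq : ∀ ε > 0, ∃ n : ℕ, ∀ t, (n : ℝ) ≤ t → c t 1 ^ 2 * M m ≤ ε ^ 2 * M m := by
      intro ε hε
      obtain ⟨n, hn⟩ := hsmall ε hε
      refine ⟨n, fun t ht => mul_le_mul_of_nonneg_right ?_ hMnn⟩
      have h1 := hn t ht
      have h2 := (hc t (n.cast_nonneg.trans ht)).2.2
      nlinarith
    by_cases hα : alpha γ = 0
    · obtain rfl := eq_four_thirds_of_alpha_eq_zero hα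
      obtain ⟨n, hn⟩ := hsmall (e m ^ 4) (pow_pos (he m) 4)
      have hn0 : (0 : ℝ) ≤ n := n.cast_nonneg
      have hy := hc.abs_y_le_of_radiation hn0 (hM m) hbm (fun t ht => by
        have h1 := hn t ht
        have h2 := (hc t (hn0.trans ht)).2.2
        have h3 : c t 1 ^ 2 ≤ e m ^ 8 := by
          have : e m ^ 8 = (e m ^ 4) ^ 2 := by ring
          rw [this]
          nlinarith
        calc c t 1 ^ 2 * M m ≤ e m ^ 8 * M m := mul_le_mul_of_nonneg_right h3 hMnn
          _ ≤ 1 / 24 := by rw [mul_comm]; exact heM m)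
      obtain ⟨k, hk⟩ := exists_nat_ge
        (√((m : ℝ) ^ 2 + R ^ 2 + 2 * (3 + M m * R ^ 2) + (3 + M m * R ^ 2)))
      refine Or.inr (mem_iUnion.2 ⟨m, mem_iUnion.2 ⟨k, mem_iUnion.2 ⟨n, c, rfl,
        fun t ht => ⟨(hc t ht.1).1.mono Icc_subset_Ici_self, ?_⟩, fun t => c (n + t),
        by simp, hc.shift hn0, fun t ht => ⟨hbm _ (by positivity), hn _ (by linarith),
          hy _ (by linarith)⟩⟩⟩⟩)
      rw [mem_closedBall_zero_iff]
      exact (norm_le_of_mem_collapsing (hc t ht.1).2 (hbm t ht.1) (hM m _ (hbm t ht.1)).1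
        (hbd t ht.1).2).trans hk
    · exfalso
      have hαpos : 0 < |alpha γ| := abs_pos.2 hα
      -- The cap `1` gives `ε² ≤ ε`, and the other bound then makes `ε² M` at most `|α|/16`.
      obtain ⟨n, hn⟩ := hsq (min 1 (|alpha γ| / (16 * (M m + 1))))
        (lt_min one_pos (by positivity))
      refine hc.false_of_alpha_ne_zero hγ₀ hγ₂ hα n.cast_nonneg (hM m) hbm fun t ht =>
        (hn t ht).trans ?_
      set ε := min 1 (|alpha γ| / (16 * (M m + 1))) with hε
      have hε0 : 0 < ε := lt_min one_pos (by positivity)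
      have hε1 : ε ≤ 1 := min_le_left _ _
      have hε2 : ε ≤ |alpha γ| / (16 * (M m + 1)) := min_le_right _ _
      rw [le_div_iff₀ (by positivity)] at hε2
      nlinarith [mul_nonneg hε0.le hMnn]

end Null

end ScalarCollapse

/-- The system preserves the constraint and the sign condition `x < 0`; and for almost every
initial state with respect to the three-dimensional (Hausdorff, i.e. surface) measure on the
constraint manifold, `|φ|` has upper limit `+∞` at the end of the maximal right interval. -/
theorem theorem2p1 (V : ℝ → ℝ) (hV : ScalarCollapse.PotentialClass V)
    (γ : ℝ) (hγ₀ : 0 ≤ γ) (hγ₂ : γ ≤ 2) :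
    (∀ (c : ℝ → ScalarCollapse.Phase) (T : EReal),
      ScalarCollapse.IsMaximalForwardSolution (ScalarCollapse.field V γ) c T →
      c 0 ∈ ScalarCollapse.collapsing V →
      ∀ τ ∈ ScalarCollapse.forwardInterval T, c τ ∈ ScalarCollapse.collapsing V) ∧
    ∀ᵐ p ∂(Measure.hausdorffMeasure 3 : Measure ScalarCollapse.Phase),
      p ∈ ScalarCollapse.collapsing V →
      ∀ (c : ℝ → ScalarCollapse.Phase) (T : EReal),
        ScalarCollapse.IsMaximalForwardSolution (ScalarCollapse.field V γ) c T →
        c 0 = p →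
        limsup (fun τ : ℝ => ((|c τ 0| : ℝ) : EReal)) (ScalarCollapse.towardsEnd T) = ⊤ := by
  have hV2 := hV.contDiff
  have hinv : ∀ (c : ℝ → ScalarCollapse.Phase) (T : EReal),
      ScalarCollapse.IsMaximalForwardSolution (ScalarCollapse.field V γ) c T →
      c 0 ∈ ScalarCollapse.collapsing V →
      ∀ τ ∈ ScalarCollapse.forwardInterval T, c τ ∈ ScalarCollapse.collapsing V := by
    intro c T hc h0 τ hτ
    have hsub := ScalarCollapse.Icc_subset_forwardInterval hτ
    exact ScalarCollapse.mem_collapsing_of_hasDerivWithinAt (hV2.differentiable two_ne_zero)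
      (fun t ht => (hc.1.2 t (hsub ht)).mono hsub) h0 τ ⟨hτ.1, le_rfl⟩
  refine ⟨hinv, ?_⟩
  filter_upwards [measure_eq_zero_iff_ae_notMem.1
    (ScalarCollapse.hausdorffMeasure_bounded_orbit_eq_zero hV2 hγ₀ hγ₂)] with p hp hpS c T hc hcp
  by_contra hlim
  subst hcp
  have hS := hinv c T hc hpS
  have h0mem : (0 : ℝ) ∈ ScalarCollapse.forwardInterval T := ⟨le_rfl, by exact_mod_cast hc.1.1⟩
  have hcont : ContinuousOn (fun t => c t 0) (ScalarCollapse.forwardInterval T) := fun t ht =>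
    (ScalarCollapse.hasDerivWithinAt_components (hc.1.2 t ht)).1.continuousWithinAt
  obtain ⟨N, hN⟩ := ScalarCollapse.exists_bound_of_limsup_ne_top hc.1.1 hcont hlim
  have hmono := ScalarCollapse.monotoneOn_x
    (ScalarCollapse.ordConnected_forwardInterval T).convex hγ₀
    (fun t ht => ⟨hc.1.2 t ht, hS t ht⟩)
  have hR : ∀ t ∈ ScalarCollapse.forwardInterval T, |c t 1| ≤ |c 0 1| := fun t ht => by
    have h1 := hmono h0mem ht ht.1
    have h2 := (hS t ht).2
    rw [abs_of_neg h2, abs_of_neg hpS.2]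
    exact neg_le_neg h1
  obtain ⟨M, hM⟩ := ScalarCollapse.exists_potential_bound hV2 N
  -- Bounded `φ` and `x` bound the whole state through the constraint, so the solution cannot end in
  -- finite time.
  have hT : T = ⊤ := hc.eq_top (ScalarCollapse.contDiff_field hV2)
    (isCompact_closedBall (0 : ScalarCollapse.Phase) _) fun t ht => mem_closedBall_zero_iff.2
      (ScalarCollapse.norm_le_of_mem_collapsing (hS t ht) (hN t ht) (hM _ (hN t ht)).1 (hR t ht))
  subst hT
  rw [ScalarCollapse.forwardInterval_top] at hS hN hR
  have hder := hc.1.2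
  rw [ScalarCollapse.forwardInterval_top] at hder
  exact hp ⟨c, rfl, fun t ht => ⟨hder t ht, hS t ht⟩, N, |c 0 1|,
    fun t ht => ⟨hN t ht, hR t ht⟩⟩
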